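/- Let $M=\mathbb S^1\times\mathbb S^1$, with points $p=(p_1,p_2)$ given by angles mod $2\pi$, let $d\mu=\frac1{4\pi^2}\,dp_1\,dp_2$ be the uniform probability measure on $M$, and let $$k(p,q)=\bigl(\sin(p_1-p_2)-\sin(q_1-q_2)\bigr)^2 .$$ A density is a Borel function $f\ge 0$ on $M$ with $\int_M f\,d\mu=1$; put $U[f](p)=\int_M k(p,q)f(q)\,d\mu(q)$. For $b>0$, a solution of Onsager's equation is a density $f$ with $$f=Z_b[f]^{-1}e^{-bU[f]},\qquad Z_b[f]=\int_M e^{-bU[f]}\,d\mu,$$ and a free energy minimizer is a density that minimizes $$\mathcal E_b[f]=\int_M\Bigl\{\log f+\frac b2\,U[f]\Bigr\}f\,d\mu\in(-\infty,+\infty]$$ among all densities. A limit point of solutions (respectively minimizers) as $b\to\infty$ is a Borel probability measure $\nu$ on $M$ such that $f_n\,d\mu\to\nu$ weakly for some sequence $b_n\to\infty$ of positive numbers and some solutions (respectively minimizers) $f_n$ at $b=b_n$. Let $\nu_0$ be the uniform probability measure on the union of the two circles $\{p_1-p_2\equiv 0\}$ and $\{p_1-p_2\equiv\pi\}$ (mod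 $2\pi$), and let $\nu_\pm$ be the uniform probability measure on the circle $\{p_1-p_2\equiv\pm\frac\pi2 \pmod{2\pi}\}$. Then: 1. The set of limit points of solutions of Onsager's equation as $b\to\infty$ is exactly $\{\nu_0,\nu_+,\nu_-\}$. 2. The set of limit points of free energy minimizers as $b\to\infty$ is exactly $\{\nu_+,\nu_-\}$. 3. The three measures are distinct; $\nu_0$, $\nu_+$, $\nu_-$ are concentrated on $\sin(p_1-p_2)=0$, $1$, $-1$ respectively. The triangle with vertices $0$, $(\cos p_1,\sin p_1)$, $(\cos p_2,\sin p_2)$, in this order, has oriented area $0$ for $\nu_0$-almost every $p$, $-\frac12$ for $\nu_+$-almost every $p$, and $+\frac12$ for $\nu_-$-almost every $p$; that is, $\nu_\pm$ are carried by triangles of area $\frac12$ with opposite orientations. -/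

import Mathlib

open MeasureTheory Filter Topology

namespace Corpora

noncomputable section

section Framework

variable {M : Type*} [MeasurableSpace M]

/-- Probability densities with respect to `μ`: Borel functions `f ≥ 0` with `∫ f dμ = 1`. -/
structure IsDensity (μ : Measure M) (f : M → ℝ) : Prop where
  measurable : Measurable f
  nonneg : ∀ p, 0 ≤ f p
  integrable : Integrable f μ
  integral_eq_one : ∫ p, f p ∂μ = 1

/-- The potential `U[f](p) = ∫ k(p,q) f(q) dμ(q)`. -/
def potential (μ : Measure M) (k : M → M → ℝ) (f : M → ℝ) (p : M) : ℝ :=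
  ∫ q, k p q * f q ∂μ

/-- The partition function `Z_b[f] = ∫ exp(-b U[f]) dμ`. -/
def partitionFunction (μ : Measure M) (k : M → M → ℝ) (b : ℝ) (f : M → ℝ) : ℝ :=
  ∫ p, Real.exp (-b * potential μ k f p) ∂μ

/-- Solutions of Onsager's equation `f = Z_b[f]⁻¹ exp(-b U[f])`. -/
def IsOnsagerSolution (μ : Measure M) (k : M → M → ℝ) (b : ℝ) (f : M → ℝ) : Prop :=
  IsDensity μ f ∧
    ∀ p, f p = (partitionFunction μ k b f)⁻¹ * Real.exp (-b * potential μ k f p)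

open Classical in
/-- The free energy `∫ (log f + (b/2) U[f]) f dμ` of a density, an element of `(-∞, +∞]`.
For `k ≥ 0`, `b > 0` the integrand is bounded below (by `-1/e`, with `0 log 0 = 0`), so over a
probability measure the integral is `+∞` exactly when the integrand is not integrable. -/
def freeEnergy (μ : Measure M) (k : M → M → ℝ) (b : ℝ) (f : M → ℝ) : EReal :=
  if Integrable (fun p => (Real.log (f p) + b / 2 * potential μ k f p) * f p) μ then
    ((∫ p, (Real.log (f p) + b / 2 * potential μ k f p) * f p ∂μ : ℝ) : EReal)
  else ⊤

/-- Minimizers of the free energy among all probability densities. -/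
def IsFreeEnergyMinimizer (μ : Measure M) (k : M → M → ℝ) (b : ℝ) (g : M → ℝ) : Prop :=
  IsDensity μ g ∧ ∀ f, IsDensity μ f → freeEnergy μ k b g ≤ freeEnergy μ k b f

/-- For a class of densities `S b`, `b > 0`, the set of limit points, as `b → ∞`, of the
measures `f dμ` with `f` in `S b`: the weak limits of sequences `f n dμ` with `f n` in `S (b n)`
and `b n → ∞`. -/
def limitPoints [TopologicalSpace M] [OpensMeasurableSpace M] (μ : Measure M)
    (S : ℝ → (M → ℝ) → Prop) : Set (ProbabilityMeasure M) :=
  {ν | ∃ (b : ℕ → ℝ) (f : ℕ → M → ℝ) (P : ℕ → ProbabilityMeasure M),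
    (∀ n, 0 < b n) ∧ Tendsto b atTop atTop ∧ (∀ n, S (b n) (f n)) ∧
    (∀ n, (P n : Measure M) = μ.withDensity (fun p => ENNReal.ofReal (f n p))) ∧
    Tendsto P atTop (𝓝 ν)}

end Framework

instance fact_two_pi_pos : Fact (0 < 2 * Real.pi) := ⟨Real.two_pi_pos⟩

/-- The configuration space `𝕊¹ × 𝕊¹` of two-rods, in terms of the angles `(p₁, p₂)` mod `2π`. -/
abbrev TwoRod : Type := AddCircle (2 * Real.pi) × AddCircle (2 * Real.pi)

/-- `sin (p₁ - p₂)`. -/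
def sinDiff (p : TwoRod) : ℝ := Real.sin_periodic.lift (p.1 - p.2)

/-- The oriented area of the triangle with vertices `0`, `(cos p₁, sin p₁)`, `(cos p₂, sin p₂)`. -/
def orientedArea (p : TwoRod) : ℝ :=
  (Real.cos_periodic.lift p.1 * Real.sin_periodic.lift p.2 -
    Real.sin_periodic.lift p.1 * Real.cos_periodic.lift p.2) / 2

/-- The interaction kernel. -/
def twoRodKernel (p q : TwoRod) : ℝ := (sinDiff p - sinDiff q) ^ 2

/-- The uniform probability measure `dp₁ dp₂ / (4π²)`. -/
def twoRodMeasure : Measure TwoRod :=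
  (AddCircle.haarAddCircle (T := 2 * Real.pi)).prod AddCircle.haarAddCircle

/-- The uniform probability measure on the circle `{(p₁, p₂) | p₁ - p₂ = θ}`. -/
def circleMeasure (θ : AddCircle (2 * Real.pi)) : Measure TwoRod :=
  (AddCircle.haarAddCircle (T := 2 * Real.pi)).map (fun q => (q + θ, q))

instance circleMeasure_isProbabilityMeasure (θ : AddCircle (2 * Real.pi)) :
    IsProbabilityMeasure (circleMeasure θ) :=
  Measure.isProbabilityMeasure_map (Continuous.measurable (by fun_prop)).aemeasurable

/-- The uniform probability measure on `{p₁ - p₂ ≡ π/2 mod 2π}`. -/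
def nuPlus : ProbabilityMeasure TwoRod :=
  ⟨circleMeasure ((Real.pi / 2 : ℝ) : AddCircle (2 * Real.pi)), inferInstance⟩

/-- The uniform probability measure on `{p₁ - p₂ ≡ -π/2 mod 2π}`. -/
def nuMinus : ProbabilityMeasure TwoRod :=
  ⟨circleMeasure ((-(Real.pi / 2) : ℝ) : AddCircle (2 * Real.pi)), inferInstance⟩

/-- The uniform probability measure on `{p₁ - p₂ ≡ 0 mod π}`, the union of the two circles
`p₁ - p₂ = 0` and `p₁ - p₂ = π`. -/
def nuZero : ProbabilityMeasure TwoRod :=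
  ⟨(2⁻¹ : ENNReal) • circleMeasure 0 +
      (2⁻¹ : ENNReal) • circleMeasure ((Real.pi : ℝ) : AddCircle (2 * Real.pi)),
    ⟨by simp [ENNReal.inv_two_add_inv_two]⟩⟩

end

end Corpora

/-! Expanding the square in the kernel, with `s = sinDiff`, gives `U[f] = (s - m)² + Var`, where `m`
is the mean of `s` under `f`. The constant cancels on normalizing, so solutions are exactly the
densities `quadDensity` proportional to `exp (-b (s - a)²)` whose centre `a` equals their mean.
Everything depends on `p₁ - p₂` only, so a shear reduces the analysis to one circle.

As `b → ∞` with `a → a₀`, such a density concentrates on `s = a₀`. It remains to find the possible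
`a₀`. Integrating derivatives of periodic functions yields two moment identities. If `a₀ ≠ 0`, the
first forces `2b E(s - a)² → 1/2`; the second then becomes `(1 - a₀²)/2 = 1 - a₀²`, so `a₀ = ±1`
(`limit_of_fixedPoints`). The level set of `0` consists of two circles, which get equal weight
because `θ ↦ π - θ` preserves the sine and swaps them.

For minimizers, the Gibbs variational identity bounds the energy below by `-log Z(m)`, so minimizers
are the densities whose centre maximizes `Z = quadPartition`. The sine is flat at its maximum, so
`Z(1)` is at least of order `b^(-1/4)`, while `Z(a) E(1 - s²) = O(b^(-1/2))`. At a maximizing centre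
`E(1 - s²) → 0`, whence `a₀ = ±1` (`limit_of_isMax`). -/

namespace Corpora

noncomputable section

/-! ### Reduction to one real parameter, and the Gibbs variational principle. -/

section Gibbs

variable {M : Type*} [MeasurableSpace M]

/-- The partition function `∫ exp (-b (s - a)²) dμ`. -/
def quadPartition (μ : Measure M) (s : M → ℝ) (b a : ℝ) : ℝ :=
  ∫ p, Real.exp (-b * (s p - a) ^ 2) ∂μ

/-- The normalized density proportional to `exp (-b (s - a)²)`. -/
def quadDensity (μ : Measure M) (s : M → ℝ) (b a : ℝ) (p : M) : ℝ :=
  (quadPartition μ s b a)⁻¹ * Real.exp (-b * (s p - a) ^ 2)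

theorem integrable_of_abs_le {μ : Measure M} [IsFiniteMeasure μ] {g : M → ℝ} (C : ℝ)
    (hg : Measurable g) (hC : ∀ p, |g p| ≤ C) : Integrable g μ :=
  Integrable.of_bound hg.aestronglyMeasurable C (ae_of_all _ hC)

theorem IsDensity.integrable_mul {μ : Measure M} {f g : M → ℝ} (hf : IsDensity μ f) (C : ℝ)
    (hg : Measurable g) (hC : ∀ p, |g p| ≤ C) : Integrable (fun p => g p * f p) μ :=
  hf.integrable.bdd_mul hg.aestronglyMeasurable (ae_of_all _ hC)

variable {μ : Measure M} {s f : M → ℝ}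

theorem IsDensity.abs_mean_le (hf : IsDensity μ f) (hs1 : ∀ p, |s p| ≤ 1) :
    |∫ q, s q * f q ∂μ| ≤ 1 := by
  rw [← hf.integral_eq_one, ← Real.norm_eq_abs]
  refine norm_integral_le_of_norm_le hf.integrable (ae_of_all _ fun p => ?_)
  rw [norm_mul, Real.norm_of_nonneg (hf.nonneg p)]
  exact mul_le_of_le_one_left (hf.nonneg p) (hs1 p)

theorem IsDensity.integral_sub_sq (hf : IsDensity μ f) (hs : Measurable s)
    (hs1 : ∀ p, |s p| ≤ 1) (a : ℝ) :
    ∫ q, (s q - a) ^ 2 * f q ∂μ =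
      ∫ q, s q ^ 2 * f q ∂μ - 2 * a * ∫ q, s q * f q ∂μ + a ^ 2 := by
  have h1 := hf.integrable_mul 1 hs hs1
  have h2 : Integrable (fun p => s p ^ 2 * f p) μ :=
    hf.integrable_mul 1 (by fun_prop) fun p => by
      rw [abs_pow]; exact pow_le_one₀ (abs_nonneg _) (hs1 p)
  have : ∀ q, (s q - a) ^ 2 * f q = s q ^ 2 * f q - 2 * a * (s q * f q) + a ^ 2 * f q :=
    fun q => by ring
  have h3 : Integrable (fun p => s p ^ 2 * f p - 2 * a * (s p * f p)) μ :=
    h2.sub (h1.const_mul _)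
  simp_rw [this]
  rw [integral_add h3 (hf.integrable.const_mul _),
    integral_sub h2 (h1.const_mul _), integral_const_mul, integral_const_mul, hf.integral_eq_one]
  ring

theorem IsDensity.potential_eq (hf : IsDensity μ f) (hs : Measurable s)
    (hs1 : ∀ p, |s p| ≤ 1) (p : M) :
    potential μ (fun p q => (s p - s q) ^ 2) f p =
      (s p - ∫ q, s q * f q ∂μ) ^ 2 +
        (∫ q, s q ^ 2 * f q ∂μ - (∫ q, s q * f q ∂μ) ^ 2) := by
  have : potential μ (fun p q => (s p - s q) ^ 2) f p = ∫ q, (s q - s p) ^ 2 * f q ∂μ := by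
    unfold potential; congr 1; ext q; ring
  rw [this, hf.integral_sub_sq hs hs1]
  ring

/-- The variance term of the potential does not depend on `p`, so it drops out on normalization. -/
theorem IsDensity.onsagerMap_eq (hf : IsDensity μ f) (hs : Measurable s)
    (hs1 : ∀ p, |s p| ≤ 1) (b : ℝ) (p : M) :
    (partitionFunction μ (fun p q => (s p - s q) ^ 2) b f)⁻¹ *
        Real.exp (-b * potential μ (fun p q => (s p - s q) ^ 2) f p) =
      quadDensity μ s b (∫ q, s q * f q ∂μ) p := by
  have h : ∀ p, Real.exp (-b * potential μ (fun p q => (s p - s q) ^ 2) f p) =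
      Real.exp (-b * (∫ q, s q ^ 2 * f q ∂μ - (∫ q, s q * f q ∂μ) ^ 2)) *
        Real.exp (-b * (s p - ∫ q, s q * f q ∂μ) ^ 2) := fun p => by
    rw [hf.potential_eq hs hs1, ← Real.exp_add]; congr 1; ring
  unfold partitionFunction quadDensity quadPartition
  simp_rw [h]
  rw [integral_const_mul, mul_inv]
  field_simp

theorem IsDensity.integrable_freeEnergy_iff (hf : IsDensity μ f) (hs : Measurable s)
    (hs1 : ∀ p, |s p| ≤ 1) (b : ℝ) :
    Integrable (fun p => (Real.log (f p) +
        b / 2 * potential μ (fun p q => (s p - s q) ^ 2) f p) * f p) μ ↔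
      Integrable (fun p => Real.log (f p) * f p) μ := by
  have h : Integrable (fun p => b / 2 *
      potential μ (fun p q => (s p - s q) ^ 2) f p * f p) μ := by
    -- The potential is bounded, since `|s - m| ≤ 2`; hence only the entropy can fail to be
    -- integrable.
    refine hf.integrable_mul (|b / 2| * (4 + |∫ q, s q ^ 2 * f q ∂μ -
      (∫ q, s q * f q ∂μ) ^ 2|)) ?_ fun p => ?_
    · simp_rw [hf.potential_eq hs hs1]; fun_prop
    · rw [abs_mul, hf.potential_eq hs hs1]
      refine mul_le_mul_of_nonneg_left ((abs_add_le _ _).trans ?_) (abs_nonneg _)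
      refine add_le_add_left ?_ _
      rw [abs_of_nonneg (sq_nonneg _), ← sq_abs]
      have := abs_sub (s p) (∫ q, s q * f q ∂μ)
      nlinarith [hs1 p, hf.abs_mean_le hs1, abs_nonneg (s p - ∫ q, s q * f q ∂μ)]
  simp_rw [add_mul]
  exact integrable_add_iff_integrable_left' h

/-- The average of `U[f]` under `f` is twice the variance of `s`, which turns `b / 2` into `b`. -/
theorem IsDensity.integral_freeEnergy (hf : IsDensity μ f) (hs : Measurable s)
    (hs1 : ∀ p, |s p| ≤ 1) (b : ℝ) (hi : Integrable (fun p => Real.log (f p) * f p) μ) :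
    ∫ p, (Real.log (f p) + b / 2 * potential μ (fun p q => (s p - s q) ^ 2) f p) * f p ∂μ =
      ∫ p, Real.log (f p) * f p ∂μ +
        b * ∫ p, (s p - ∫ q, s q * f q ∂μ) ^ 2 * f p ∂μ := by
  set m := ∫ q, s q * f q ∂μ with hm
  have h2 : Integrable (fun p => (s p - m) ^ 2 * f p) μ :=
    hf.integrable_mul 4 (by fun_prop) fun p => by
      rw [abs_pow]
      have := abs_sub (s p) m
      nlinarith [hs1 p, hf.abs_mean_le hs1, abs_nonneg (s p - m)]
  have : ∀ p, (Real.log (f p) + b / 2 * potential μ (fun p q => (s p - s q) ^ 2) f p) * f p =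
      Real.log (f p) * f p + (b / 2 * ((s p - m) ^ 2 * f p) +
        b / 2 * (∫ q, s q ^ 2 * f q ∂μ - m ^ 2) * f p) := fun p => by
    rw [hf.potential_eq hs hs1]; ring
  have h3 : Integrable (fun p => b / 2 * ((s p - m) ^ 2 * f p) +
      b / 2 * (∫ q, s q ^ 2 * f q ∂μ - m ^ 2) * f p) μ :=
    (h2.const_mul _).add (hf.integrable.const_mul _)
  simp_rw [this]
  rw [integral_add hi h3,
    integral_add (h2.const_mul _) (hf.integrable.const_mul _), integral_const_mul,
    integral_const_mul, hf.integral_eq_one, hf.integral_sub_sq hs hs1 m]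
  simp only [← hm]
  ring

variable [IsProbabilityMeasure μ]

theorem integrable_quadWeight (hs : Measurable s) {b : ℝ} (hb : 0 ≤ b) (a : ℝ) :
    Integrable (fun p => Real.exp (-b * (s p - a) ^ 2)) μ := by
  refine integrable_of_abs_le 1 (by fun_prop) fun p => ?_
  rw [abs_of_pos (Real.exp_pos _), Real.exp_le_one_iff]
  nlinarith [mul_nonneg hb (sq_nonneg (s p - a))]

theorem quadPartition_pos (hs : Measurable s) {b : ℝ} (hb : 0 ≤ b) (a : ℝ) :
    0 < quadPartition μ s b a :=
  integral_exp_pos (integrable_quadWeight hs hb a)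

theorem quadDensity_pos (hs : Measurable s) {b : ℝ} (hb : 0 ≤ b) (a : ℝ) (p : M) :
    0 < quadDensity μ s b a p :=
  mul_pos (inv_pos.2 (quadPartition_pos hs hb a)) (Real.exp_pos _)

theorem isDensity_quadDensity (hs : Measurable s) {b : ℝ} (hb : 0 ≤ b) (a : ℝ) :
    IsDensity μ (quadDensity μ s b a) where
  measurable := by unfold quadDensity; fun_prop
  nonneg p := (quadDensity_pos hs hb a p).le
  integrable := (integrable_quadWeight hs hb a).const_mul _
  integral_eq_one := by
    unfold quadDensity
    rw [integral_const_mul]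
    exact inv_mul_cancel₀ (quadPartition_pos hs hb a).ne'

theorem log_quadDensity (hs : Measurable s) {b : ℝ} (hb : 0 ≤ b) (a : ℝ) (p : M) :
    Real.log (quadDensity μ s b a p) = -Real.log (quadPartition μ s b a) - b * (s p - a) ^ 2 := by
  unfold quadDensity
  rw [Real.log_mul (inv_pos.2 (quadPartition_pos hs hb a)).ne' (Real.exp_pos _).ne',
    Real.log_inv, Real.log_exp]
  ring

theorem isOnsagerSolution_iff (hs : Measurable s) (hs1 : ∀ p, |s p| ≤ 1) {b : ℝ} (hb : 0 ≤ b) :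
    IsOnsagerSolution μ (fun p q => (s p - s q) ^ 2) b f ↔
      ∃ a, |a| ≤ 1 ∧ ∫ q, s q * quadDensity μ s b a q ∂μ = a ∧ f = quadDensity μ s b a := by
  constructor
  · rintro ⟨hf, h⟩
    have h' : f = quadDensity μ s b (∫ q, s q * f q ∂μ) := by
      ext p; rw [h p, hf.onsagerMap_eq hs hs1]
    exact ⟨_, hf.abs_mean_le hs1, by rw [← h'], h'⟩
  · rintro ⟨a, -, ha, rfl⟩
    have hf : IsDensity μ (quadDensity μ s b a) := isDensity_quadDensity hs hb a
    refine ⟨hf, fun p => ?_⟩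
    rw [hf.onsagerMap_eq hs hs1, ha]

/-- The Gibbs variational identity. -/
theorem IsDensity.entropy_add_eq (hf : IsDensity μ f) (hs : Measurable s)
    (hs1 : ∀ p, |s p| ≤ 1) {b : ℝ} (hb : 0 ≤ b) (a : ℝ)
    (hi : Integrable (fun p => Real.log (f p) * f p) μ) :
    Integrable (fun p => quadDensity μ s b a p *
        InformationTheory.klFun (f p / quadDensity μ s b a p)) μ ∧
    ∫ p, Real.log (f p) * f p ∂μ + b * ∫ p, (s p - a) ^ 2 * f p ∂μ =
      -Real.log (quadPartition μ s b a) +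
        ∫ p, quadDensity μ s b a p *
          InformationTheory.klFun (f p / quadDensity μ s b a p) ∂μ := by
  have h2 : Integrable (fun p => (s p - a) ^ 2 * f p) μ :=
    hf.integrable_mul ((1 + |a|) ^ 2) (by fun_prop) fun p => by
      rw [abs_pow]
      have := abs_sub (s p) a
      exact pow_le_pow_left₀ (abs_nonneg _) (by linarith [hs1 p]) 2
  have hq : IsDensity μ (quadDensity μ s b a) := isDensity_quadDensity hs hb a
  -- With `klFun x = x log x + 1 - x`, the left side is `f log (f / q) + q - f`, and `log q` is
  -- explicit. Where `f = 0` both sides equal `q`.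
  have key : ∀ p, quadDensity μ s b a p *
      InformationTheory.klFun (f p / quadDensity μ s b a p) =
      Real.log (f p) * f p + b * ((s p - a) ^ 2 * f p) +
        ((Real.log (quadPartition μ s b a) - 1) * f p + quadDensity μ s b a p) := fun p => by
    have hpos := quadDensity_pos (μ := μ) hs hb a p
    have hl := log_quadDensity (μ := μ) hs hb a p
    rcases eq_or_ne (f p) 0 with h0 | h0
    · simp [h0, InformationTheory.klFun]
    · rw [InformationTheory.klFun, Real.log_div h0 hpos.ne', hl]
      field_simp
      ring
  simp_rw [key]
  have i1 : Integrable (fun p => Real.log (f p) * f p + b * ((s p - a) ^ 2 * f p)) μ :=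
    hi.add (h2.const_mul b)
  have i2 : Integrable (fun p => (Real.log (quadPartition μ s b a) - 1) * f p +
      quadDensity μ s b a p) μ := (hf.integrable.const_mul (Real.log (quadPartition μ s b a) - 1)).add hq.integrable
  refine ⟨i1.add i2, ?_⟩
  rw [integral_add i1 i2, integral_add hi (h2.const_mul b),
    integral_add (hf.integrable.const_mul _) hq.integrable, integral_const_mul,
    integral_const_mul, hf.integral_eq_one, hq.integral_eq_one]
  ring

theorem integrable_log_mul_quadDensity (hs : Measurable s) (hs1 : ∀ p, |s p| ≤ 1) {b : ℝ}
    (hb : 0 ≤ b) (a : ℝ) :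
    Integrable (fun p => Real.log (quadDensity μ s b a p) * quadDensity μ s b a p) μ := by
  simp_rw [log_quadDensity hs hb]
  refine (isDensity_quadDensity hs hb a).integrable_mul
    (|Real.log (quadPartition μ s b a)| + b * (1 + |a|) ^ 2) (by fun_prop) fun p => ?_
  refine (abs_sub _ _).trans ?_
  rw [abs_neg, abs_mul, abs_of_nonneg hb, abs_pow]
  gcongr
  exact (abs_sub _ _).trans (by linarith [hs1 p])

theorem entropy_quadDensity (hs : Measurable s) (hs1 : ∀ p, |s p| ≤ 1) {b : ℝ}
    (hb : 0 ≤ b) (a : ℝ) :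
    ∫ p, Real.log (quadDensity μ s b a p) * quadDensity μ s b a p ∂μ +
      b * ∫ p, (s p - a) ^ 2 * quadDensity μ s b a p ∂μ =
      -Real.log (quadPartition μ s b a) := by
  rw [((isDensity_quadDensity hs hb a).entropy_add_eq hs hs1 hb a
    (integrable_log_mul_quadDensity hs hs1 hb a)).2]
  have : ∀ p, quadDensity μ s b a p *
      InformationTheory.klFun (quadDensity μ s b a p / quadDensity μ s b a p) = 0 := fun p => by
    rw [div_self (quadDensity_pos hs hb a p).ne', InformationTheory.klFun_one, mul_zero]
  simp [this]

theorem IsDensity.klIntegral_nonneg (hf : IsDensity μ f) (hs : Measurable s) {b : ℝ}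
    (hb : 0 ≤ b) (a : ℝ) (p : M) :
    0 ≤ quadDensity μ s b a p * InformationTheory.klFun (f p / quadDensity μ s b a p) := by
  have := quadDensity_pos (μ := μ) hs hb a p
  exact mul_nonneg this.le (InformationTheory.klFun_nonneg (div_nonneg (hf.nonneg p) this.le))

/-- The Gibbs identity is applied with the centre at the mean of `f`, and the relative entropy is
dropped. -/
theorem freeEnergy_ge (hf : IsDensity μ f) (hs : Measurable s)
    (hs1 : ∀ p, |s p| ≤ 1) {b : ℝ} (hb : 0 ≤ b) :
    ((-Real.log (quadPartition μ s b (∫ q, s q * f q ∂μ)) : ℝ) : EReal) ≤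
      freeEnergy μ (fun p q => (s p - s q) ^ 2) b f := by
  unfold freeEnergy
  split_ifs with hi
  · have hi' := (hf.integrable_freeEnergy_iff hs hs1 b).1 hi
    rw [hf.integral_freeEnergy hs hs1 b hi',
      (hf.entropy_add_eq hs hs1 hb _ hi').2, EReal.coe_le_coe_iff]
    exact le_add_of_nonneg_right (integral_nonneg (hf.klIntegral_nonneg hs hb _))
  · exact le_top

/-- The mean need not be `a`: the correction is the difference between the second moment about `a`
and the variance. -/
theorem freeEnergy_quadDensity (hs : Measurable s) (hs1 : ∀ p, |s p| ≤ 1) {b : ℝ}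
    (hb : 0 ≤ b) (a : ℝ) :
    freeEnergy μ (fun p q => (s p - s q) ^ 2) b (quadDensity μ s b a) =
      ((-Real.log (quadPartition μ s b a) -
        b * (∫ q, s q * quadDensity μ s b a q ∂μ - a) ^ 2 : ℝ) : EReal) := by
  have hf : IsDensity μ (quadDensity μ s b a) := isDensity_quadDensity hs hb a
  have hi' := integrable_log_mul_quadDensity (μ := μ) hs hs1 hb a
  unfold freeEnergy
  rw [if_pos ((hf.integrable_freeEnergy_iff hs hs1 b).2 hi'),
    hf.integral_freeEnergy hs hs1 b hi', ← entropy_quadDensity hs hs1 hb a,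
    hf.integral_sub_sq hs hs1, hf.integral_sub_sq hs hs1]
  congr 1
  ring

/-- No derivative of `Z` is needed. If `m` is the mean, `freeEnergy_ge` gives `-log Z(m) ≤ -log Z(a)
- b (m - a)²`, and maximality leaves only `m = a`. -/
theorem mean_eq_of_isMax (hs : Measurable s) (hs1 : ∀ p, |s p| ≤ 1) {b : ℝ}
    (hb : 0 < b) {a : ℝ}
    (hmax : ∀ a', |a'| ≤ 1 → quadPartition μ s b a' ≤ quadPartition μ s b a) :
    ∫ q, s q * quadDensity μ s b a q ∂μ = a := by
  have hf : IsDensity μ (quadDensity μ s b a) := isDensity_quadDensity hs hb.le a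
  have h := freeEnergy_ge hf hs hs1 hb.le
  rw [freeEnergy_quadDensity hs hs1 hb.le, EReal.coe_le_coe_iff] at h
  have h2 := Real.log_le_log (quadPartition_pos hs hb.le _) (hmax _ (hf.abs_mean_le hs1))
  have h3 : b * (∫ q, s q * quadDensity μ s b a q ∂μ - a) ^ 2 ≤ 0 := by linarith
  have h4 : (∫ q, s q * quadDensity μ s b a q ∂μ - a) ^ 2 ≤ 0 := by
    by_contra hc
    push Not at hc
    exact absurd (mul_pos hb hc) (not_lt.2 h3)
  exact sub_eq_zero.1 (pow_eq_zero_iff two_ne_zero |>.1 (le_antisymm h4 (sq_nonneg _)))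

theorem isFreeEnergyMinimizer_of_isMax (hs : Measurable s) (hs1 : ∀ p, |s p| ≤ 1) {b : ℝ}
    (hb : 0 < b) {a : ℝ}
    (hmax : ∀ a', |a'| ≤ 1 → quadPartition μ s b a' ≤ quadPartition μ s b a) :
    IsFreeEnergyMinimizer μ (fun p q => (s p - s q) ^ 2) b (quadDensity μ s b a) := by
  refine ⟨isDensity_quadDensity hs hb.le a, fun f hf => ?_⟩
  refine le_trans ?_ (freeEnergy_ge hf hs hs1 hb.le)
  rw [freeEnergy_quadDensity hs hs1 hb.le, EReal.coe_le_coe_iff]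
  have h2 := Real.log_le_log (quadPartition_pos hs hb.le _) (hmax _ (hf.abs_mean_le hs1))
  nlinarith [mul_nonneg hb.le (sq_nonneg (∫ q, s q * quadDensity μ s b a q ∂μ - a))]

theorem continuous_quadPartition (hs : Measurable s) {b : ℝ} (hb : 0 ≤ b) :
    Continuous (quadPartition μ s b) := by
  refine continuous_of_dominated (bound := fun _ => 1)
    (fun a => (integrable_quadWeight hs hb a).aestronglyMeasurable)
    (fun a => ae_of_all _ fun p => ?_) (integrable_const _)
    (ae_of_all _ fun p => by fun_prop)
  rw [Real.norm_eq_abs, abs_of_pos (Real.exp_pos _), Real.exp_le_one_iff]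
  nlinarith [mul_nonneg hb (sq_nonneg (s p - a))]

theorem exists_isMax_quadPartition (hs : Measurable s) {b : ℝ} (hb : 0 ≤ b) :
    ∃ a, |a| ≤ 1 ∧ ∀ a', |a'| ≤ 1 → quadPartition μ s b a' ≤ quadPartition μ s b a := by
  obtain ⟨a, ha, h⟩ := (isCompact_Icc (a := (-1 : ℝ)) (b := 1)).exists_isMaxOn ⟨0, by simp⟩
    (continuous_quadPartition (μ := μ) hs hb).continuousOn
  exact ⟨a, abs_le.2 ha, fun a' ha' => h (abs_le.1 ha')⟩

/-- Comparison with a maximizing centre forces equality in the Gibbs bound, so the relative entropy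
vanishes. The energy ignores null sets, hence equality only almost everywhere. -/
theorem IsFreeEnergyMinimizer.exists_ae_eq (hs : Measurable s)
    (hs1 : ∀ p, |s p| ≤ 1) {b : ℝ} (hb : 0 < b)
    (hf : IsFreeEnergyMinimizer μ (fun p q => (s p - s q) ^ 2) b f) :
    ∃ a, |a| ≤ 1 ∧ ∫ q, s q * quadDensity μ s b a q ∂μ = a ∧
      (∀ a', |a'| ≤ 1 → quadPartition μ s b a' ≤ quadPartition μ s b a) ∧
      f =ᵐ[μ] quadDensity μ s b a := by
  obtain ⟨hd, hmin⟩ := hf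
  obtain ⟨a₀, ha₀, hmax₀⟩ := exists_isMax_quadPartition (μ := μ) hs hb.le
  set m := ∫ q, s q * f q ∂μ with hm
  have hm1 : |m| ≤ 1 := hd.abs_mean_le hs1
  have hle := hmin _ (isDensity_quadDensity hs hb.le a₀)
  rw [freeEnergy_quadDensity hs hs1 hb.le, mean_eq_of_isMax hs hs1 hb hmax₀] at hle
  have hi : Integrable (fun p => (Real.log (f p) +
        b / 2 * potential μ (fun p q => (s p - s q) ^ 2) f p) * f p) μ := by
    by_contra hc
    unfold freeEnergy at hle
    rw [if_neg hc] at hle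
    exact absurd hle (not_le.2 (EReal.coe_lt_top _))
  have hi' := (hd.integrable_freeEnergy_iff hs hs1 b).1 hi
  obtain ⟨hk, hE⟩ := hd.entropy_add_eq hs hs1 hb.le m hi'
  unfold freeEnergy at hle
  rw [if_pos hi, hd.integral_freeEnergy hs hs1 b hi', hE, EReal.coe_le_coe_iff] at hle
  have hk0 : 0 ≤ ∫ p, quadDensity μ s b m p *
      InformationTheory.klFun (f p / quadDensity μ s b m p) ∂μ :=
    integral_nonneg (hd.klIntegral_nonneg hs hb.le m)
  have hlog := Real.log_le_log (quadPartition_pos hs hb.le _) (hmax₀ m hm1)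
  simp only [sub_self, ne_eq, OfNat.ofNat_ne_zero, not_false_eq_true, zero_pow, mul_zero,
    sub_zero] at hle
  have hZ : quadPartition μ s b a₀ ≤ quadPartition μ s b m :=
    (Real.log_le_log_iff (quadPartition_pos hs hb.le _) (quadPartition_pos hs hb.le _)).1
      (by linarith)
  have hmax : ∀ a', |a'| ≤ 1 → quadPartition μ s b a' ≤ quadPartition μ s b m :=
    fun a' ha' => (hmax₀ a' ha').trans hZ
  refine ⟨m, hm1, mean_eq_of_isMax hs hs1 hb hmax, hmax, ?_⟩
  have hzero := (integral_eq_zero_iff_of_nonneg (hd.klIntegral_nonneg hs hb.le m) hk).1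
    (by linarith)
  filter_upwards [hzero] with p hp
  have hpos := quadDensity_pos (μ := μ) hs hb.le m p
  have := (InformationTheory.klFun_eq_zero_iff (div_nonneg (hd.nonneg p) hpos.le)).1
    ((mul_eq_zero.1 hp).resolve_left hpos.ne')
  exact (div_eq_one_iff_eq hpos.ne').1 this

end Gibbs

/-! ### Laplace-type concentration on a level set of `s`. -/

section Concentration

variable {M : Type*} [MeasurableSpace M] [TopologicalSpace M] [BorelSpace M]
  {μ : Measure M} [IsProbabilityMeasure μ] [μ.IsOpenPosMeasure] {s : M → ℝ}
  {b a : ℕ → ℝ} {a₀ : ℝ}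

/-- On the nonempty open set `|s - a₀| < ε/4` the weight is at least `exp (-b ε²/4)`, which bounds
`Z` below. Where `|s - a₀| ≥ ε`, eventually `|s - a| ≥ 3ε/4`. -/
theorem exists_quadDensity_le_exp (hs : Continuous s) (ha₀ : a₀ ∈ Set.range s)
    (hb : ∀ n, 0 < b n) (ha : Tendsto a atTop (𝓝 a₀)) {ε : ℝ} (hε : 0 < ε) :
    ∃ K, 0 < K ∧ ∀ᶠ n in atTop, ∀ p, ε ≤ |s p - a₀| →
      quadDensity μ s (b n) (a n) p ≤ K * Real.exp (-(ε ^ 2 / 4) * b n) := by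
  set A : Set M := {p | |s p - a₀| < ε / 4} with hA
  have hAo : IsOpen A := isOpen_lt (by fun_prop) continuous_const
  have hAne : A.Nonempty := by
    obtain ⟨p, hp⟩ := ha₀
    exact ⟨p, by simp only [hA, Set.mem_ofPred_eq, hp, sub_self, abs_zero]; positivity⟩
  have hκ : 0 < μ.real A :=
    ENNReal.toReal_pos (hAo.measure_pos μ hAne).ne' (measure_ne_top _ _)
  refine ⟨(μ.real A)⁻¹, inv_pos.2 hκ, ?_⟩
  filter_upwards [Metric.tendsto_nhds.1 ha (ε / 4) (by positivity)] with n hn p hp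
  rw [Real.dist_eq] at hn
  have hbn := hb n
  have hZ : μ.real A * Real.exp (-(ε ^ 2 / 4) * b n) ≤ quadPartition μ s (b n) (a n) := by
    have hint := integrable_quadWeight (μ := μ) hs.measurable hbn.le (a n)
    calc μ.real A * Real.exp (-(ε ^ 2 / 4) * b n)
        = ∫ _ in A, Real.exp (-(ε ^ 2 / 4) * b n) ∂μ := by simp
      _ ≤ ∫ p in A, Real.exp (-b n * (s p - a n) ^ 2) ∂μ := by
          refine setIntegral_mono_on (by simp) hint.integrableOn hAo.measurableSet
            fun q hq => Real.exp_le_exp.2 ?_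
          have hq' : |s q - a₀| < ε / 4 := hq
          have h1 : |s q - a n| ≤ ε / 2 := by
            rw [abs_lt] at hq' hn
            rw [abs_le]; constructor <;> linarith [hq'.1, hq'.2, hn.1, hn.2]
          have h2 : (s q - a n) ^ 2 ≤ (ε / 2) ^ 2 := by
            rw [← sq_abs]; gcongr
          nlinarith
      _ ≤ quadPartition μ s (b n) (a n) :=
          setIntegral_le_integral hint (ae_of_all _ fun _ => (Real.exp_pos _).le)
  -- `(3/4)² = 9/16 ≥ 1/2`, so the far weight is at most the square of the factor in the lower bound
  -- for `Z`.
  have hw : Real.exp (-b n * (s p - a n) ^ 2) ≤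
      Real.exp (-(ε ^ 2 / 4) * b n) * Real.exp (-(ε ^ 2 / 4) * b n) := by
    rw [← Real.exp_add]
    refine Real.exp_le_exp.2 ?_
    have h1 : 3 * ε / 4 ≤ |s p - a n| := by
      have := abs_sub_le (s p) (a n) a₀
      linarith
    have h2 : (3 * ε / 4) ^ 2 ≤ (s p - a n) ^ 2 := by
      rw [← sq_abs (s p - a n)]; gcongr
    nlinarith [mul_pos hbn (pow_pos hε 2)]
  set e := Real.exp (-(ε ^ 2 / 4) * b n)
  have he : 0 < e := Real.exp_pos _
  unfold quadDensity
  calc (quadPartition μ s (b n) (a n))⁻¹ * Real.exp (-b n * (s p - a n) ^ 2)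
      ≤ (μ.real A * e)⁻¹ * (e * e) := by gcongr
    _ = (μ.real A)⁻¹ * e := by field_simp

theorem tendsto_exp_neg_mul {c : ℝ} (hc : 0 < c) (hb : Tendsto b atTop atTop) :
    Tendsto (fun n => Real.exp (-c * b n)) atTop (𝓝 0) := by
  refine Real.tendsto_exp_atBot.comp ?_
  exact hb.const_mul_atTop_of_neg (neg_neg_of_pos hc)

theorem tendsto_mul_exp_neg_mul {c : ℝ} (hc : 0 < c) (hb : Tendsto b atTop atTop) :
    Tendsto (fun n => b n * Real.exp (-c * b n)) atTop (𝓝 0) := by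
  have h := (Real.tendsto_pow_mul_exp_neg_atTop_nhds_zero 1).comp (hb.const_mul_atTop hc)
  have h2 := h.const_mul c⁻¹
  rw [mul_zero] at h2
  refine h2.congr fun n => ?_
  simp only [Function.comp, pow_one]
  rw [neg_mul]
  field_simp

/-- The test function only has to be constant on the level set `s = a₀`, not globally determined by
`s`. -/
theorem tendsto_integral_mul_quadDensity [CompactSpace M] (hs : Continuous s)
    (ha₀ : a₀ ∈ Set.range s) (hb : ∀ n, 0 < b n) (hbt : Tendsto b atTop atTop)
    (ha : Tendsto a atTop (𝓝 a₀)) {h : M → ℝ} (hh : Continuous h) {c : ℝ}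
    (hc : ∀ p, s p = a₀ → h p = c) :
    Tendsto (fun n => ∫ p, h p * quadDensity μ s (b n) (a n) p ∂μ) atTop (𝓝 c) := by
  obtain ⟨C, hC⟩ : ∃ C, ∀ p, |h p - c| ≤ C := by
    obtain ⟨C, hC⟩ := isCompact_univ.exists_bound_of_continuousOn
      (f := fun p => h p - c) (by fun_prop)
    exact ⟨C, fun p => hC p trivial⟩
  have hC0 : 0 ≤ C := by
    obtain ⟨p, -⟩ := ha₀
    exact (abs_nonneg _).trans (hC p)
  rw [Metric.tendsto_nhds]
  intro η hη
  -- On the compact set where `|h - c| ≥ η/2`, the function `|s - a₀|` is positive, hence bounded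
  -- away from zero.
  obtain ⟨ε, hε, hεh⟩ : ∃ ε > 0, ∀ p, |s p - a₀| < ε → |h p - c| < η / 2 := by
    have hk : IsCompact {p | η / 2 ≤ |h p - c|} :=
      (isClosed_le continuous_const (by fun_prop)).isCompact
    obtain ⟨ε, hε, hle⟩ := hk.exists_forall_le' (f := fun p => |s p - a₀|) (a := 0)
      (by fun_prop) fun p hp => abs_pos.2 fun h0 => by
        have hp' : η / 2 ≤ |h p - c| := hp
        rw [hc p (sub_eq_zero.1 h0), sub_self, abs_zero] at hp'
        linarith
    refine ⟨ε, hε, fun p hp => ?_⟩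
    by_contra hcon
    exact absurd (hle p (not_lt.1 hcon)) (not_le.2 hp)
  obtain ⟨K, hK, hev⟩ := exists_quadDensity_le_exp (μ := μ) hs ha₀ hb ha hε
  have ht : Tendsto (fun n => C * (K * Real.exp (-(ε ^ 2 / 4) * b n))) atTop (𝓝 0) := by
    simpa using ((tendsto_exp_neg_mul (by positivity : 0 < ε ^ 2 / 4) hbt).const_mul K).const_mul C
  filter_upwards [hev, ht.eventually_lt_const (half_pos hη)] with n hn hn2
  have hq : IsDensity μ (quadDensity μ s (b n) (a n)) :=
    isDensity_quadDensity hs.measurable (hb n).le (a n)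
  have hi : Integrable (fun p => (h p - c) * quadDensity μ s (b n) (a n) p) μ :=
    hq.integrable_mul C (by fun_prop) hC
  have hi2 : Integrable (fun p => h p * quadDensity μ s (b n) (a n) p) μ :=
    (hi.add (hq.integrable.const_mul c)).congr (ae_of_all _ fun p => by
      simp only [Pi.add_apply]; ring)
  have heq : ∫ p, h p * quadDensity μ s (b n) (a n) p ∂μ - c =
      ∫ p, (h p - c) * quadDensity μ s (b n) (a n) p ∂μ := by
    simp_rw [sub_mul]
    rw [integral_sub hi2 (hq.integrable.const_mul c), integral_const_mul, hq.integral_eq_one,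
      mul_one]
  rw [Real.dist_eq, heq, ← Real.norm_eq_abs]
  have hg : Integrable (fun p => η / 2 * quadDensity μ s (b n) (a n) p +
      C * (K * Real.exp (-(ε ^ 2 / 4) * b n))) μ :=
    (hq.integrable.const_mul _).add (integrable_const _)
  refine (norm_integral_le_of_norm_le hg (ae_of_all _ fun p => ?_)).trans_lt ?_
  · rw [norm_mul, Real.norm_of_nonneg (hq.nonneg p), Real.norm_eq_abs]
    have h0 := hq.nonneg p
    by_cases hp : |s p - a₀| < ε
    · refine le_add_of_le_of_nonneg ?_ (by positivity)
      exact mul_le_mul_of_nonneg_right (hεh p hp).le h0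
    · refine le_add_of_nonneg_of_le (by positivity) ?_
      exact mul_le_mul (hC p) (hn p (not_lt.1 hp)) h0 hC0
  · rw [integral_add (hq.integrable.const_mul _) (integrable_const _), integral_const_mul,
      hq.integral_eq_one]
    simp only [integral_const, probReal_univ, one_smul, mul_one]
    linarith

/-- Near the level set one factor `|s - a|` is at most `ε`; elsewhere the density is exponentially
small. The bound is relative to the scaled second moment because that moment is not yet known to be
bounded. -/
theorem exists_cubic_moment_le (hs : Continuous s) (hs1 : ∀ p, |s p| ≤ 1)
    (ha₀ : a₀ ∈ Set.range s) (hb : ∀ n, 0 < b n) (hbt : Tendsto b atTop atTop)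
    (ha : Tendsto a atTop (𝓝 a₀)) (ha1 : ∀ n, |a n| ≤ 1) {ε : ℝ} (hε : 0 < ε) :
    ∃ t : ℕ → ℝ, Tendsto t atTop (𝓝 0) ∧ ∀ᶠ n in atTop,
      ∫ p, 2 * b n * |s p - a n| ^ 3 * quadDensity μ s (b n) (a n) p ∂μ ≤
        ε * ∫ p, 2 * b n * (s p - a n) ^ 2 * quadDensity μ s (b n) (a n) p ∂μ + t n := by
  obtain ⟨K, hK, hev⟩ := exists_quadDensity_le_exp (μ := μ) hs ha₀ hb ha (half_pos hε)
  refine ⟨fun n => 16 * K * (b n * Real.exp (-((ε / 2) ^ 2 / 4) * b n)), ?_, ?_⟩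
  · simpa using (tendsto_mul_exp_neg_mul (by positivity : 0 < (ε / 2) ^ 2 / 4) hbt).const_mul
      (16 * K)
  filter_upwards [hev, Metric.tendsto_nhds.1 ha (ε / 2) (half_pos hε)] with n hn han
  rw [Real.dist_eq] at han
  have hbn := hb n
  have hq : IsDensity μ (quadDensity μ s (b n) (a n)) :=
    isDensity_quadDensity hs.measurable (hb n).le (a n)
  have hd : ∀ p, |s p - a n| ≤ 2 := fun p =>
    (abs_sub _ _).trans (by linarith [hs1 p, ha1 n])
  have i3 : Integrable (fun p => 2 * b n * |s p - a n| ^ 3 * quadDensity μ s (b n) (a n) p) μ :=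
    hq.integrable_mul (2 * b n * 2 ^ 3) (by have := hs.measurable; fun_prop) fun p => by
      rw [abs_of_nonneg (by positivity)]
      gcongr
      exact hd p
  have i2 : Integrable (fun p => 2 * b n * (s p - a n) ^ 2 * quadDensity μ s (b n) (a n) p) μ :=
    hq.integrable_mul (2 * b n * 2 ^ 2) (by have := hs.measurable; fun_prop) fun p => by
      rw [abs_of_nonneg (by positivity), ← sq_abs]
      gcongr
      exact hd p
  set e := Real.exp (-((ε / 2) ^ 2 / 4) * b n)
  have he : 0 < e := Real.exp_pos _
  have key : ∫ p, 2 * b n * |s p - a n| ^ 3 * quadDensity μ s (b n) (a n) p ∂μ ≤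
      ∫ p, (ε * (2 * b n * (s p - a n) ^ 2 * quadDensity μ s (b n) (a n) p) +
        16 * K * (b n * e)) ∂μ := by
    refine integral_mono i3 ((i2.const_mul ε).add (integrable_const _)) fun p => ?_
    have h0 := hq.nonneg p
    simp only
    by_cases hp : |s p - a₀| < ε / 2
    · refine le_add_of_le_of_nonneg ?_ (by positivity)
      have h1 : |s p - a n| ≤ ε := by
        rw [abs_lt] at hp han
        rw [abs_le]; constructor <;> linarith [hp.1, hp.2, han.1, han.2]
      calc 2 * b n * |s p - a n| ^ 3 * quadDensity μ s (b n) (a n) p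
          = |s p - a n| * (2 * b n * |s p - a n| ^ 2 * quadDensity μ s (b n) (a n) p) := by ring
        _ ≤ _ := by rw [sq_abs]; gcongr
    · refine le_add_of_nonneg_of_le (by positivity) ?_
      calc 2 * b n * |s p - a n| ^ 3 * quadDensity μ s (b n) (a n) p
          ≤ 2 * b n * 2 ^ 3 * (K * e) := by
            gcongr
            · exact hd p
            · exact hn p (not_lt.1 hp)
        _ = 16 * K * (b n * e) := by ring
  rw [integral_add (i2.const_mul ε) (integrable_const _), integral_const_mul] at key
  simpa using key

end Concentration

/-! ### The sine on the circle: moment identities and possible limits of the centres. -/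

section Circle

/-- The uniform probability measure on the circle `ℝ / 2πℤ`. -/
abbrev haarCircle : Measure (AddCircle (2 * Real.pi)) := AddCircle.haarAddCircle

/-- The sine function on the circle `ℝ / 2πℤ`. -/
def circleSin (t : AddCircle (2 * Real.pi)) : ℝ := Real.sin_periodic.lift t

@[simp]
theorem circleSin_coe (x : ℝ) : circleSin (x : AddCircle (2 * Real.pi)) = Real.sin x := rfl

@[simp]
theorem circleSin_zero : circleSin 0 = 0 := Real.sin_zero

@[fun_prop]
theorem continuous_circleSin : Continuous circleSin :=
  Real.continuous_sin.quotient_liftOn' _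

theorem abs_circleSin_le (t : AddCircle (2 * Real.pi)) : |circleSin t| ≤ 1 := by
  induction t using QuotientAddGroup.induction_on with
  | H x => exact Real.abs_sin_le_one x

theorem mem_range_circleSin {a : ℝ} (ha : |a| ≤ 1) : a ∈ Set.range circleSin :=
  ⟨(Real.arcsin a : ℝ), by
    rw [circleSin_coe, Real.sin_arcsin (abs_le.1 ha).1 (abs_le.1 ha).2]⟩

theorem integral_haarCircle (g : AddCircle (2 * Real.pi) → ℝ) :
    ∫ t, g t ∂haarCircle = (2 * Real.pi)⁻¹ * ∫ x in 0..2 * Real.pi, g x := by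
  have h := AddCircle.intervalIntegral_preimage (2 * Real.pi) 0 g
  rw [zero_add] at h
  rw [AddCircle.integral_haarAddCircle, h, smul_eq_mul]

theorem integral_haarCircle_eq_zero_of_hasDerivAt {g : AddCircle (2 * Real.pi) → ℝ}
    (hg : Continuous g) {F : ℝ → ℝ} (hF : ∀ x : ℝ, HasDerivAt F (g x) x)
    (hper : F (2 * Real.pi) = F 0) : ∫ t, g t ∂haarCircle = 0 := by
  have hc : Continuous fun x : ℝ => g x := hg.comp (AddCircle.continuous_mk' _)
  rw [integral_haarCircle, intervalIntegral.integral_eq_sub_of_hasDerivAt (fun x _ => hF x)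
    (hc.intervalIntegrable _ _), hper, sub_self, mul_zero]

theorem integrable_haarCircle {g : AddCircle (2 * Real.pi) → ℝ} (hg : Continuous g) :
    Integrable g haarCircle :=
  hg.integrable_of_hasCompactSupport (HasCompactSupport.of_compactSpace g)

/-- The density on the circle proportional to `exp (-b (sin - a)²)`. -/
abbrev circleDensity (b a : ℝ) : AddCircle (2 * Real.pi) → ℝ :=
  quadDensity haarCircle circleSin b a

@[fun_prop]
theorem continuous_circleDensity (b a : ℝ) : Continuous (circleDensity b a) := by
  unfold circleDensity quadDensity; fun_prop

theorem isDensity_circleDensity {b : ℝ} (hb : 0 ≤ b) (a : ℝ) :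
    IsDensity haarCircle (circleDensity b a) :=
  isDensity_quadDensity continuous_circleSin.measurable hb a

theorem hasDerivAt_circleDensity (b a x : ℝ) :
    HasDerivAt (fun x : ℝ => circleDensity b a x)
      (-(2 * b * (Real.sin x - a) * Real.cos x) * circleDensity b a x) x := by
  have h : HasDerivAt (fun x : ℝ => -b * (Real.sin x - a) ^ 2)
      (-b * (2 * (Real.sin x - a) * Real.cos x)) x := by
    simpa using (((Real.hasDerivAt_sin x).sub_const a).pow 2).const_mul (-b)
  have h2 := h.exp.const_mul (quadPartition haarCircle circleSin b a)⁻¹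
  refine h2.congr_deriv ?_
  simp only [quadDensity, circleSin_coe]
  ring

section FixedPoint

variable {b a : ℝ}

/-- Integrates the derivative of `-cos · ρ`, with `ρ` the density, and expands `1 - s²` in powers of
`s - a`. The linear term vanishes by `hfix`. -/
theorem circle_moment_identity_one (hb : 0 ≤ b)
    (hfix : ∫ t, circleSin t * circleDensity b a t ∂haarCircle = a) :
    2 * a * (∫ t, 2 * b * (circleSin t - a) ^ 2 * circleDensity b a t ∂haarCircle) +
      ∫ t, 2 * b * (circleSin t - a) ^ 3 * circleDensity b a t ∂haarCircle = a := by
  have h0 : ∫ t, (circleSin t + 2 * b * (circleSin t - a) * (1 - circleSin t ^ 2)) *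
      circleDensity b a t ∂haarCircle = 0 := by
    refine integral_haarCircle_eq_zero_of_hasDerivAt (by fun_prop)
      (F := fun x => -(Real.cos x * circleDensity b a x)) (fun x => ?_) ?_
    · refine ((Real.hasDerivAt_cos x).mul (hasDerivAt_circleDensity b a x)).neg.congr_deriv ?_
      rw [circleSin_coe, ← Real.cos_sq' x]
      ring
    · simp [quadDensity]
  have hq := isDensity_circleDensity hb a
  have key : ∀ t, (circleSin t + 2 * b * (circleSin t - a) * (1 - circleSin t ^ 2)) *
      circleDensity b a t = (1 + 2 * b * (1 - a ^ 2)) * (circleSin t * circleDensity b a t) -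
        2 * b * (1 - a ^ 2) * a * circleDensity b a t -
        (2 * a * (2 * b * (circleSin t - a) ^ 2 * circleDensity b a t) +
          2 * b * (circleSin t - a) ^ 3 * circleDensity b a t) := fun t => by ring
  simp_rw [key] at h0
  rw [integral_sub (integrable_haarCircle (by fun_prop)) (integrable_haarCircle (by fun_prop)),
    integral_sub (integrable_haarCircle (by fun_prop)) (integrable_haarCircle (by fun_prop)),
    integral_add (integrable_haarCircle (by fun_prop)) (integrable_haarCircle (by fun_prop)),
    integral_const_mul, integral_const_mul, integral_const_mul, hfix, hq.integral_eq_one] at h0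
  linarith

/-- Integrates the derivative of `cos · (sin - a) · ρ`, using `1 - s² = (1 - a²) - (s - a)(s + a)`.
-/
theorem circle_moment_identity_two (hb : 0 ≤ b)
    (hfix : ∫ t, circleSin t * circleDensity b a t ∂haarCircle = a) :
    (1 - a ^ 2) * (∫ t, 2 * b * (circleSin t - a) ^ 2 * circleDensity b a t ∂haarCircle) -
      ∫ t, 2 * b * (circleSin t - a) ^ 3 * (circleSin t + a) * circleDensity b a t ∂haarCircle =
    1 + a ^ 2 - 2 * ∫ t, circleSin t ^ 2 * circleDensity b a t ∂haarCircle := by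
  have h0 : ∫ t, (1 - circleSin t ^ 2 - circleSin t * (circleSin t - a) -
      2 * b * (circleSin t - a) ^ 2 * (1 - circleSin t ^ 2)) *
      circleDensity b a t ∂haarCircle = 0 := by
    refine integral_haarCircle_eq_zero_of_hasDerivAt (by fun_prop)
      (F := fun x => Real.cos x * (Real.sin x - a) * circleDensity b a x) (fun x => ?_) ?_
    · refine (((Real.hasDerivAt_cos x).mul ((Real.hasDerivAt_sin x).sub_const a)).mul
        (hasDerivAt_circleDensity b a x)).congr_deriv ?_
      simp only [circleSin_coe, Pi.mul_apply]
      rw [← Real.cos_sq' x]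
      ring
    · simp [quadDensity]
  have hq := isDensity_circleDensity hb a
  have key : ∀ t, (1 - circleSin t ^ 2 - circleSin t * (circleSin t - a) -
      2 * b * (circleSin t - a) ^ 2 * (1 - circleSin t ^ 2)) * circleDensity b a t =
      (circleDensity b a t - 2 * (circleSin t ^ 2 * circleDensity b a t) +
        a * (circleSin t * circleDensity b a t)) -
      ((1 - a ^ 2) * (2 * b * (circleSin t - a) ^ 2 * circleDensity b a t) -
        2 * b * (circleSin t - a) ^ 3 * (circleSin t + a) * circleDensity b a t) :=
    fun t => by ring
  simp_rw [key] at h0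
  rw [integral_sub (integrable_haarCircle (by fun_prop)) (integrable_haarCircle (by fun_prop)),
    integral_add (integrable_haarCircle (by fun_prop)) (integrable_haarCircle (by fun_prop)),
    integral_sub (integrable_haarCircle (by fun_prop)) (integrable_haarCircle (by fun_prop)),
    integral_sub (integrable_haarCircle (by fun_prop)) (integrable_haarCircle (by fun_prop)),
    integral_const_mul, integral_const_mul, integral_const_mul, hfix, hq.integral_eq_one] at h0
  linarith

theorem abs_circle_cubic_le (hb : 0 ≤ b) {h : AddCircle (2 * Real.pi) → ℝ} {C : ℝ} (hC : ∀ t, |h t| ≤ C) :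
    |∫ t, 2 * b * (circleSin t - a) ^ 3 * h t * circleDensity b a t ∂haarCircle| ≤
      C * ∫ t, 2 * b * |circleSin t - a| ^ 3 * circleDensity b a t ∂haarCircle := by
  have hq := isDensity_circleDensity hb a
  rw [← integral_const_mul, ← Real.norm_eq_abs]
  refine norm_integral_le_of_norm_le (integrable_haarCircle (by fun_prop))
    (ae_of_all _ fun t => ?_)
  rw [Real.norm_eq_abs, abs_mul, abs_mul, abs_mul, abs_of_nonneg (hq.nonneg t), abs_pow,
    abs_of_nonneg (by positivity : 0 ≤ 2 * b), mul_comm _ |h t|, mul_assoc]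
  exact mul_le_mul_of_nonneg_right (hC t)
    (mul_nonneg (by positivity) (hq.nonneg t))

end FixedPoint

/-- A limit of a sequence of means of solutions is a critical value of the sine. -/
theorem limit_of_fixedPoints {b a : ℕ → ℝ} {a₀ : ℝ} (hb : ∀ n, 0 < b n)
    (hbt : Tendsto b atTop atTop) (ha : Tendsto a atTop (𝓝 a₀)) (ha1 : ∀ n, |a n| ≤ 1)
    (hfix : ∀ n, ∫ t, circleSin t * circleDensity (b n) (a n) t ∂haarCircle = a n) :
    a₀ = 0 ∨ a₀ = 1 ∨ a₀ = -1 := by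
  by_cases h0 : a₀ = 0
  · exact Or.inl h0
  right
  have ha₀ : |a₀| ≤ 1 := le_of_tendsto ha.abs (Eventually.of_forall ha1)
  have hr := mem_range_circleSin ha₀
  set A : ℕ → ℝ := fun n => ∫ t, 2 * b n * (circleSin t - a n) ^ 2 *
    circleDensity (b n) (a n) t ∂haarCircle with hA
  set R : ℕ → ℝ := fun n => ∫ t, 2 * b n * |circleSin t - a n| ^ 3 *
    circleDensity (b n) (a n) t ∂haarCircle with hR
  have hR0 : ∀ n, 0 ≤ R n := fun n => integral_nonneg fun t =>
    mul_nonneg (mul_nonneg (by linarith [hb n]) (by positivity))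
      ((isDensity_circleDensity (hb n).le (a n)).nonneg t)
  have e1 : ∀ n, |a n| * |1 - 2 * A n| ≤ R n := fun n => by
    have h1 := circle_moment_identity_one (hb n).le (hfix n)
    have h2 := abs_circle_cubic_le (a := a n) (hb n).le (h := fun _ => 1) (C := 1) (by simp)
    simp only [mul_one, one_mul] at h2
    rw [← abs_mul]
    convert! h2 using 2
    linarith
  have e2 : ∀ n, |(1 - a n ^ 2) * A n - (1 + a n ^ 2 -
      2 * ∫ t, circleSin t ^ 2 * circleDensity (b n) (a n) t ∂haarCircle)| ≤ 2 * R n := fun n => by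
    have h1 := circle_moment_identity_two (hb n).le (hfix n)
    have h2 := abs_circle_cubic_le (a := a n) (hb n).le
      (h := fun t => circleSin t + a n) (C := 2) fun t =>
        (abs_add_le _ _).trans (by linarith [abs_circleSin_le t, ha1 n])
    convert! h2 using 2
    linarith
  have hRt : ∀ ε > 0, ∃ t : ℕ → ℝ, Tendsto t atTop (𝓝 0) ∧
      ∀ᶠ n in atTop, R n ≤ ε * A n + t n := fun ε hε =>
    exists_cubic_moment_le (μ := haarCircle) continuous_circleSin abs_circleSin_le hr hb hbt ha
      ha1 hε
  have hκ : 0 < |a₀| / 2 := by positivity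
  have haκ : ∀ᶠ n in atTop, |a₀| / 2 < |a n| :=
    ha.abs.eventually_const_lt (by linarith)
  -- A priori bound: with `κ = |a₀| / 2`, if `A > 2` then `κ (2A - 1) ≤ R ≤ κ A + t` with `t < κ`,
  -- which gives `A < 2`.
  have hA2 : ∀ᶠ n in atTop, A n ≤ 2 := by
    obtain ⟨t, ht, hle⟩ := hRt _ hκ
    filter_upwards [haκ, hle, ht.eventually_lt_const hκ] with n h1 h2 h3
    by_contra! hc
    have h4 : 2 * A n - 1 ≤ |1 - 2 * A n| := by rw [abs_sub_comm]; exact le_abs_self _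
    have h5 : |a₀| / 2 * (2 * A n - 1) ≤ |a n| * |1 - 2 * A n| :=
      mul_le_mul h1.le h4 (by linarith) (abs_nonneg _)
    nlinarith [e1 n]
  have hRlim : Tendsto R atTop (𝓝 0) := by
    rw [Metric.tendsto_nhds]
    intro ε hε
    obtain ⟨t, ht, hle⟩ := hRt (ε / 4) (by positivity)
    filter_upwards [hA2, hle, ht.eventually_lt_const (half_pos hε)] with n h1 h2 h3
    rw [Real.dist_eq, sub_zero, abs_of_nonneg (hR0 n)]
    nlinarith
  have hAlim : Tendsto A atTop (𝓝 (1 / 2)) := by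
    rw [tendsto_iff_dist_tendsto_zero]
    refine squeeze_zero' (Eventually.of_forall fun _ => dist_nonneg) ?_
      (by simpa using hRlim.const_mul |a₀|⁻¹)
    filter_upwards [haκ] with n h1
    have h2 : |a₀| / 2 * |1 - 2 * A n| ≤ R n :=
      (mul_le_mul_of_nonneg_right h1.le (abs_nonneg _)).trans (e1 n)
    have h3 : |1 - 2 * A n| = 2 * |A n - 1 / 2| := by
      rw [abs_sub_comm, ← abs_of_pos (two_pos : (0 : ℝ) < 2), ← abs_mul,
        abs_of_pos (two_pos : (0 : ℝ) < 2)]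
      congr 1; ring
    rw [Real.dist_eq, le_inv_mul_iff₀ (abs_pos.2 h0)]
    rw [h3] at h2
    linarith
  have hS2 : Tendsto (fun n => ∫ t, circleSin t ^ 2 * circleDensity (b n) (a n) t ∂haarCircle)
      atTop (𝓝 (a₀ ^ 2)) :=
    tendsto_integral_mul_quadDensity continuous_circleSin hr hb hbt ha (by fun_prop)
      fun p hp => by rw [hp]
  have l1 := (((ha.pow 2).const_sub 1).mul hAlim).sub
    (((ha.pow 2).const_add 1).sub (hS2.const_mul 2))
  have l2 := squeeze_zero_norm (fun n => (Real.norm_eq_abs _).trans_le (e2 n)) (by simpa using hRlim.const_mul 2)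
  have h3 := tendsto_nhds_unique l1 l2
  -- The limiting second identity reads `(1 - a₀²)/2 = 1 + a₀² - 2a₀²`.
  have h4 : (a₀ - 1) * (a₀ + 1) = 0 := by linarith
  rcases mul_eq_zero.1 h4 with h | h
  · exact Or.inl (by linarith)
  · exact Or.inr (by linarith)

/-- The value of the partition function at the endpoint `1`. -/
theorem le_quadPartition_one {b r : ℝ} (hb : 0 < b) (hr : 0 < r) (hr1 : r ≤ 1)
    (hbr : b * r ^ 4 = 1) :
    (2 * Real.pi)⁻¹ * (r * Real.exp (-1)) ≤ quadPartition haarCircle circleSin b 1 := by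
  unfold quadPartition
  rw [integral_haarCircle]
  have hpi := Real.pi_gt_three
  have hc : Continuous fun x : ℝ => Real.exp (-b * (circleSin x - 1) ^ 2) := by
    simp only [circleSin_coe]; fun_prop
  gcongr
  -- Since `1 - sin x ≤ (x - π/2)²/2`, the exponent is at least `-b r⁴ = -1` within distance `r =
  -- b^(-1/4)` of `π/2`.
  calc r * Real.exp (-1) = ∫ _ in Real.pi / 2..Real.pi / 2 + r, Real.exp (-1) := by simp
    _ ≤ ∫ x in Real.pi / 2..Real.pi / 2 + r, Real.exp (-b * (circleSin x - 1) ^ 2) := by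
        refine intervalIntegral.integral_mono_on (by linarith) (by simp)
          (hc.intervalIntegrable _ _) fun x hx => Real.exp_le_exp.2 ?_
        rw [circleSin_coe]
        have h1 : 1 - (x - Real.pi / 2) ^ 2 / 2 ≤ Real.sin x := by
          rw [← Real.cos_sub_pi_div_two]; exact Real.one_sub_sq_div_two_le_cos
        have h2 : (x - Real.pi / 2) ^ 2 ≤ r ^ 2 := by
          have := hx.1; have := hx.2
          exact pow_le_pow_left₀ (by linarith) (by linarith) 2
        have h3 : (Real.sin x - 1) ^ 2 ≤ (r ^ 2) ^ 2 := by
          rw [← neg_sq]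
          exact pow_le_pow_left₀ (by linarith [Real.sin_le_one x]) (by nlinarith) 2
        nlinarith
    _ ≤ ∫ x in 0..2 * Real.pi, Real.exp (-b * (circleSin x - 1) ^ 2) := by
        refine intervalIntegral.integral_mono_interval (by linarith) (by linarith) (by linarith)
          (ae_of_all _ fun x => (Real.exp_pos _).le) (hc.intervalIntegrable _ _)

theorem abs_integral_gaussian_le {b : ℝ} (hb : 0 < b) (a x : ℝ) :
    |∫ y in 0..x, Real.exp (-b * (y - a) ^ 2)| ≤ √(Real.pi / b) := by
  have hi : Integrable fun y : ℝ => Real.exp (-b * (y - a) ^ 2) :=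
    (integrable_exp_neg_mul_sq hb).comp_sub_right a
  have h0 : ∫ y, Real.exp (-b * (y - a) ^ 2) = √(Real.pi / b) := by
    rw [← integral_gaussian b]
    exact integral_sub_right_eq_self (fun y => Real.exp (-b * y ^ 2)) a
  rw [intervalIntegral.abs_integral_eq_abs_integral_uIoc,
    abs_of_nonneg (integral_nonneg fun _ => (Real.exp_pos _).le), ← h0]
  exact setIntegral_le_integral hi (ae_of_all _ fun _ => (Real.exp_pos _).le)

/-- For a primitive `G` of the Gaussian, integrating the derivative of `-cos · G(sin)` replaces `∫
cos² exp (-b (sin - a)²)` by `∫ sin · G(sin)`, and `|G|` is at most the full Gaussian integral. The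
factor `cos²` compensates the flatness of the sine at `±1`. -/
theorem quadPartition_mul_le {b : ℝ} (hb : 0 < b) (a : ℝ) :
    quadPartition haarCircle circleSin b a *
      ∫ t, (1 - circleSin t ^ 2) * circleDensity b a t ∂haarCircle ≤ √(Real.pi / b) := by
  set G : ℝ → ℝ := fun x => ∫ y in 0..x, Real.exp (-b * (y - a) ^ 2) with hG
  have hGd : ∀ x, HasDerivAt G (Real.exp (-b * (x - a) ^ 2)) x := fun x =>
    intervalIntegral.integral_hasDerivAt_right
      (Continuous.intervalIntegrable (by fun_prop) _ _)
      (Continuous.stronglyMeasurableAtFilter (by fun_prop) _ _)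
      (Continuous.continuousAt (by fun_prop))
  have hGc : Continuous G := continuous_iff_continuousAt.2 fun x => (hGd x).continuousAt
  have h0 : ∫ t, (circleSin t * G (circleSin t) -
      (1 - circleSin t ^ 2) * Real.exp (-b * (circleSin t - a) ^ 2)) ∂haarCircle = 0 := by
    refine integral_haarCircle_eq_zero_of_hasDerivAt (by fun_prop)
      (F := fun x => -(Real.cos x * G (Real.sin x))) (fun x => ?_) (by simp)
    refine ((Real.hasDerivAt_cos x).mul
      ((hGd (Real.sin x)).comp x (Real.hasDerivAt_sin x))).neg.congr_deriv ?_
    simp only [circleSin_coe, Function.comp_apply]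
    rw [← Real.cos_sq' x]
    ring
  rw [integral_sub (integrable_haarCircle (by fun_prop)) (integrable_haarCircle (by fun_prop)),
    sub_eq_zero] at h0
  have hZ := quadPartition_pos (μ := haarCircle) continuous_circleSin.measurable hb.le a
  have h1 : quadPartition haarCircle circleSin b a *
      ∫ t, (1 - circleSin t ^ 2) * circleDensity b a t ∂haarCircle =
      ∫ t, (1 - circleSin t ^ 2) * Real.exp (-b * (circleSin t - a) ^ 2) ∂haarCircle := by
    rw [← integral_const_mul]
    congr 1
    ext t
    simp only [quadDensity]
    field_simp
  rw [h1, ← h0]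
  have h2 : ∫ t, circleSin t * G (circleSin t) ∂haarCircle ≤
      ∫ _, √(Real.pi / b) ∂haarCircle := by
    refine integral_mono (integrable_haarCircle (by fun_prop)) (integrable_const _) fun t => ?_
    refine (le_abs_self _).trans ?_
    rw [abs_mul]
    exact (mul_le_of_le_one_left (abs_nonneg _) (abs_circleSin_le t)).trans
      (abs_integral_gaussian_le hb a _)
  simpa using h2

/-- A limit of a sequence of maximizers of the partition function is `1` or `-1`. -/
theorem limit_of_isMax {b a : ℕ → ℝ} {a₀ : ℝ} (hb : ∀ n, 0 < b n)
    (hbt : Tendsto b atTop atTop) (ha : Tendsto a atTop (𝓝 a₀)) (ha1 : ∀ n, |a n| ≤ 1)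
    (hmax : ∀ n, ∀ a', |a'| ≤ 1 → quadPartition haarCircle circleSin (b n) a' ≤
      quadPartition haarCircle circleSin (b n) (a n)) :
    a₀ = 1 ∨ a₀ = -1 := by
  have ha₀ : |a₀| ≤ 1 := le_of_tendsto ha.abs (Eventually.of_forall ha1)
  have hr := mem_range_circleSin ha₀
  set r : ℕ → ℝ := fun n => (√√(b n))⁻¹ with hrdef
  have hrpos : ∀ n, 0 < r n := fun n =>
    inv_pos.2 (Real.sqrt_pos.2 (Real.sqrt_pos.2 (hb n)))
  have hrt : Tendsto r atTop (𝓝 0) :=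
    tendsto_inv_atTop_zero.comp
      (Real.tendsto_sqrt_atTop.comp (Real.tendsto_sqrt_atTop.comp hbt))
  have hr2 : ∀ n, r n ^ 2 = (√(b n))⁻¹ := fun n => by
    simp only [hrdef]
    rw [inv_pow, Real.sq_sqrt (Real.sqrt_nonneg _)]
  have hr4 : ∀ n, b n * r n ^ 4 = 1 := fun n => by
    have : r n ^ 4 = (r n ^ 2) ^ 2 := by ring
    rw [this, hr2, inv_pow, Real.sq_sqrt (hb n).le]
    exact mul_inv_cancel₀ (hb n).ne'
  have hE : Tendsto (fun n => ∫ t, (1 - circleSin t ^ 2) *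
      circleDensity (b n) (a n) t ∂haarCircle) atTop (𝓝 (1 - a₀ ^ 2)) :=
    tendsto_integral_mul_quadDensity continuous_circleSin hr hb hbt ha (by fun_prop)
      fun p hp => by rw [hp]
  set c := (2 * Real.pi)⁻¹ * Real.exp (-1) with hc
  have hcpos : 0 < c := by positivity
  -- From `c r ≤ Z(1) ≤ Z(a)` and `Z(a) E(1 - s²) ≤ √π r²`, one factor `r` cancels.
  have hle : ∀ᶠ n in atTop, c * ∫ t, (1 - circleSin t ^ 2) *
      circleDensity (b n) (a n) t ∂haarCircle ≤ √Real.pi * r n := by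
    filter_upwards [hrt.eventually_le_const one_pos] with n hn
    have h1 := (le_quadPartition_one (hb n) (hrpos n) hn (hr4 n)).trans (hmax n 1 (by simp))
    have h2 := quadPartition_mul_le (hb n) (a n)
    have h3 : 0 ≤ ∫ t, (1 - circleSin t ^ 2) * circleDensity (b n) (a n) t ∂haarCircle :=
      integral_nonneg fun t => mul_nonneg (by
        have := abs_circleSin_le t
        rw [← sq_abs]; nlinarith [abs_nonneg (circleSin t)])
        ((isDensity_circleDensity (hb n).le (a n)).nonneg t)
    have h4 := (mul_le_mul_of_nonneg_right h1 h3).trans h2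
    rw [Real.sqrt_div Real.pi_pos.le, div_eq_mul_inv, ← hr2] at h4
    refine le_of_mul_le_mul_left ?_ (hrpos n)
    calc _ = _ := ?_
      _ ≤ _ := h4
      _ = _ := ?_
    · simp only [hc]; ring
    · ring
  have h5 : c * (1 - a₀ ^ 2) ≤ √Real.pi * 0 :=
    le_of_tendsto_of_tendsto (hE.const_mul c) (hrt.const_mul _) hle
  rw [mul_zero] at h5
  have h6 : 1 - a₀ ^ 2 ≤ 0 := by
    by_contra! h
    exact absurd (mul_pos hcpos h) (not_lt.2 h5)
  have h7 : a₀ ^ 2 ≤ 1 := by rw [← sq_abs]; exact pow_le_one₀ (abs_nonneg _) ha₀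
  exact sq_eq_one_iff.1 (by linarith)

end Circle

/-! ### Transfer to the torus, weak limits and limit points. -/

section TwoRod

theorem circleSin_neg (t : AddCircle (2 * Real.pi)) : circleSin (-t) = -circleSin t :=
  Real.Angle.sin_neg t

theorem circleSin_pi_sub (t : AddCircle (2 * Real.pi)) :
    circleSin ((Real.pi : ℝ) - t) = circleSin t := by
  induction t using QuotientAddGroup.induction_on with
  | H x => exact Real.sin_pi_sub x

theorem circleSin_eq_zero_iff {t : AddCircle (2 * Real.pi)} :
    circleSin t = 0 ↔ t = 0 ∨ t = (Real.pi : ℝ) :=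
  Real.Angle.sin_eq_zero_iff

theorem circleSin_eq_one {t : AddCircle (2 * Real.pi)} (ht : circleSin t = 1) :
    t = (Real.pi / 2 : ℝ) := by
  have h : Real.Angle.sin t = Real.Angle.sin (Real.pi / 2 : ℝ) := by
    rw [Real.Angle.sin_coe, Real.sin_pi_div_two]; exact ht
  rcases Real.Angle.sin_eq_iff_eq_or_add_eq_pi.1 h with h | h
  · exact h
  · refine (eq_sub_of_add_eq h).trans ?_
    rw [← Real.Angle.coe_sub]
    congr 1; ring

theorem circleSin_eq_neg_one {t : AddCircle (2 * Real.pi)} (ht : circleSin t = -1) :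
    t = (-(Real.pi / 2) : ℝ) := by
  have h := circleSin_eq_one (t := -t) (by rw [circleSin_neg, ht, neg_neg])
  rw [AddCircle.coe_neg, ← h, neg_neg]

theorem sinDiff_eq (p : TwoRod) : sinDiff p = circleSin (p.1 - p.2) := rfl

theorem continuous_sinDiff : Continuous sinDiff :=
  continuous_circleSin.comp (continuous_fst.sub continuous_snd)

theorem abs_sinDiff_le (p : TwoRod) : |sinDiff p| ≤ 1 := abs_circleSin_le _

theorem orientedArea_eq (p : TwoRod) : orientedArea p = -(sinDiff p / 2) := by
  obtain ⟨x, y⟩ := p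
  induction x using QuotientAddGroup.induction_on with
  | H x =>
    induction y using QuotientAddGroup.induction_on with
    | H y =>
      have h : sinDiff ((x : AddCircle (2 * Real.pi)), (y : AddCircle (2 * Real.pi))) =
        Real.sin (x - y) := rfl
      change (Real.cos x * Real.sin y - Real.sin x * Real.cos y) / 2 = _
      erw [h]
      rw [Real.sin_sub]
      ring

instance isProbabilityMeasure_twoRodMeasure : IsProbabilityMeasure twoRodMeasure := by
  unfold twoRodMeasure; infer_instance

theorem measurePreserving_shear :
    MeasurePreserving (fun p : TwoRod => (p.1 - p.2, p.2)) twoRodMeasure twoRodMeasure :=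
  measurePreserving_sub_prod haarCircle haarCircle

theorem measurePreserving_angleDiff :
    MeasurePreserving (fun p : TwoRod => p.1 - p.2) twoRodMeasure haarCircle :=
  (measurePreserving_fst (μ := haarCircle) (ν := haarCircle)).comp measurePreserving_shear

theorem integral_twoRod_angleDiff {g : AddCircle (2 * Real.pi) → ℝ} (hg : Continuous g) :
    ∫ p : TwoRod, g (p.1 - p.2) ∂twoRodMeasure = ∫ t, g t ∂haarCircle := by
  rw [← measurePreserving_angleDiff.map_eq,
    integral_map measurePreserving_angleDiff.aemeasurable hg.aestronglyMeasurable]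

theorem quadPartition_twoRod (b a : ℝ) :
    quadPartition twoRodMeasure sinDiff b a = quadPartition haarCircle circleSin b a :=
  integral_twoRod_angleDiff (g := fun t => Real.exp (-b * (circleSin t - a) ^ 2)) (by fun_prop)

theorem quadDensity_twoRod (b a : ℝ) (p : TwoRod) :
    quadDensity twoRodMeasure sinDiff b a p = circleDensity b a (p.1 - p.2) := by
  unfold circleDensity quadDensity
  rw [quadPartition_twoRod, sinDiff_eq]

theorem mean_twoRod (b a : ℝ) :
    ∫ p, sinDiff p * quadDensity twoRodMeasure sinDiff b a p ∂twoRodMeasure =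
      ∫ t, circleSin t * circleDensity b a t ∂haarCircle := by
  simp_rw [quadDensity_twoRod, sinDiff_eq]
  exact integral_twoRod_angleDiff (g := fun t => circleSin t * circleDensity b a t) (by fun_prop)

/-- The average of a function over the circle `p₁ - p₂ = θ`. -/
def fiberAverage (φ : TwoRod → ℝ) (θ : AddCircle (2 * Real.pi)) : ℝ :=
  ∫ t, φ (t + θ, t) ∂haarCircle

theorem continuous_fiberAverage {φ : TwoRod → ℝ} (hφ : Continuous φ) :
    Continuous (fiberAverage φ) := by
  have h := continuous_parametric_integral_of_continuous (μ := haarCircle)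
    (f := fun θ t : AddCircle (2 * Real.pi) => φ (t + θ, t))
    (by simp only [Function.uncurry_def]; fun_prop) isCompact_univ
  simp only [Measure.restrict_univ] at h
  exact h

theorem integral_circleMeasure {φ : TwoRod → ℝ} (hφ : Continuous φ)
    (θ : AddCircle (2 * Real.pi)) : ∫ p, φ p ∂circleMeasure θ = fiberAverage φ θ :=
  integral_map (Continuous.aemeasurable (by fun_prop)) hφ.aestronglyMeasurable

theorem integral_nuPlus {φ : TwoRod → ℝ} (hφ : Continuous φ) :
    ∫ p, φ p ∂(nuPlus : Measure TwoRod) = fiberAverage φ (Real.pi / 2 : ℝ) :=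
  integral_circleMeasure hφ _

theorem integral_nuMinus {φ : TwoRod → ℝ} (hφ : Continuous φ) :
    ∫ p, φ p ∂(nuMinus : Measure TwoRod) = fiberAverage φ (-(Real.pi / 2) : ℝ) :=
  integral_circleMeasure hφ _

theorem integrable_of_continuous_twoRod {φ : TwoRod → ℝ} (hφ : Continuous φ)
    (μ : Measure TwoRod) [IsFiniteMeasure μ] : Integrable φ μ :=
  hφ.integrable_of_hasCompactSupport (HasCompactSupport.of_compactSpace φ)

theorem integral_nuZero {φ : TwoRod → ℝ} (hφ : Continuous φ) :
    ∫ p, φ p ∂(nuZero : Measure TwoRod) =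
      2⁻¹ * (fiberAverage φ 0 + fiberAverage φ (Real.pi : ℝ)) := by
  have h : (nuZero : Measure TwoRod) = (2⁻¹ : ENNReal) • circleMeasure 0 +
      (2⁻¹ : ENNReal) • circleMeasure ((Real.pi : ℝ) : AddCircle (2 * Real.pi)) := rfl
  have h2 : (2⁻¹ : ENNReal) ≠ ⊤ := by simp
  rw [h, integral_add_measure
    ((integrable_of_continuous_twoRod hφ _).smul_measure h2)
    ((integrable_of_continuous_twoRod hφ _).smul_measure h2),
    integral_smul_measure, integral_smul_measure, integral_circleMeasure hφ,
    integral_circleMeasure hφ]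
  simp
  ring

/-- The shear `(p₁, p₂) ↦ (p₁ - p₂, p₂)` preserves the measure and the density depends on its first
coordinate only, so Fubini averages `φ` over each fibre. -/
theorem integral_mul_quadDensity_twoRod {φ : TwoRod → ℝ} (hφ : Continuous φ) (b a : ℝ) :
    ∫ p, φ p * quadDensity twoRodMeasure sinDiff b a p ∂twoRodMeasure =
      ∫ θ, fiberAverage φ θ * circleDensity b a θ ∂haarCircle := by
  have hc : Continuous fun p : TwoRod => φ (p.2 + p.1, p.2) * circleDensity b a p.1 := by
    fun_prop
  have h : ∀ p : TwoRod, φ p * quadDensity twoRodMeasure sinDiff b a p =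
      (fun p : TwoRod => φ (p.2 + p.1, p.2) * circleDensity b a p.1) (p.1 - p.2, p.2) :=
    fun p => by simp [quadDensity_twoRod]
  simp_rw [h]
  rw [← integral_map (f := fun p : TwoRod => φ (p.2 + p.1, p.2) * circleDensity b a p.1)
    measurePreserving_shear.aemeasurable hc.aestronglyMeasurable,
    measurePreserving_shear.map_eq]
  have hi := integrable_of_continuous_twoRod hc twoRodMeasure
  unfold twoRodMeasure at hi ⊢
  rw [integral_prod _ hi]
  simp_rw [integral_mul_const]
  rfl

theorem integral_reflect_mul_circleDensity (h : AddCircle (2 * Real.pi) → ℝ) (b a : ℝ) :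
    ∫ θ, h ((Real.pi : ℝ) - θ) * circleDensity b a θ ∂haarCircle =
      ∫ θ, h θ * circleDensity b a θ ∂haarCircle := by
  rw [← integral_sub_left_eq_self (fun θ => h θ * circleDensity b a θ) haarCircle
    ((Real.pi : ℝ) : AddCircle (2 * Real.pi))]
  simp only [quadDensity, circleSin_pi_sub]

theorem quadPartition_circle_neg (b a : ℝ) :
    quadPartition haarCircle circleSin b (-a) = quadPartition haarCircle circleSin b a := by
  unfold quadPartition
  rw [← integral_neg_eq_self]
  congr 1
  ext t
  rw [circleSin_neg]
  congr 1; ring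

theorem mean_circleDensity_zero (b : ℝ) :
    ∫ t, circleSin t * circleDensity b 0 t ∂haarCircle = 0 := by
  have h : ∫ t, circleSin t * circleDensity b 0 t ∂haarCircle =
      -∫ t, circleSin t * circleDensity b 0 t ∂haarCircle := by
    conv_lhs => rw [← integral_neg_eq_self]
    rw [← integral_neg]
    congr 1
    ext t
    simp only [quadDensity, circleSin_neg, sub_zero, neg_sq]
    ring
  linarith

/-- The limit of the densities `quadDensity` whose centres converge to `a₀ ∈ {0, 1, -1}`. -/
def limitMeasure (a₀ : ℝ) : ProbabilityMeasure TwoRod :=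
  if a₀ = 0 then nuZero else if a₀ = 1 then nuPlus else nuMinus

theorem limitMeasure_zero : limitMeasure 0 = nuZero := if_pos rfl

theorem limitMeasure_one : limitMeasure 1 = nuPlus := by simp [limitMeasure]

theorem limitMeasure_neg_one : limitMeasure (-1) = nuMinus := by norm_num [limitMeasure]

theorem tendsto_limitMeasure {b a : ℕ → ℝ} {a₀ : ℝ} (hb : ∀ n, 0 < b n)
    (hbt : Tendsto b atTop atTop) (ha : Tendsto a atTop (𝓝 a₀))
    (ha₀ : a₀ = 0 ∨ a₀ = 1 ∨ a₀ = -1) {P : ℕ → ProbabilityMeasure TwoRod}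
    (hP : ∀ n, (P n : Measure TwoRod) = twoRodMeasure.withDensity
      fun p => ENNReal.ofReal (quadDensity twoRodMeasure sinDiff (b n) (a n) p)) :
    Tendsto P atTop (𝓝 (limitMeasure a₀)) := by
  rw [ProbabilityMeasure.tendsto_iff_forall_integral_tendsto]
  intro φ
  have hint : ∀ n, ∫ p, φ p ∂(P n : Measure TwoRod) =
      ∫ θ, fiberAverage φ θ * circleDensity (b n) (a n) θ ∂haarCircle := fun n => by
    have hq : IsDensity twoRodMeasure (quadDensity twoRodMeasure sinDiff (b n) (a n)) :=
      isDensity_quadDensity continuous_sinDiff.measurable (hb n).le (a n)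
    rw [hP, integral_withDensity_eq_integral_toReal_smul hq.measurable.ennreal_ofReal
      (ae_of_all _ fun _ => ENNReal.ofReal_lt_top), ← integral_mul_quadDensity_twoRod φ.continuous]
    congr 1
    ext p
    rw [ENNReal.toReal_ofReal (hq.nonneg p), smul_eq_mul, mul_comm]
  simp_rw [hint]
  have hF := continuous_fiberAverage φ.continuous
  have hr : a₀ ∈ Set.range circleSin :=
    mem_range_circleSin (by rcases ha₀ with rfl | rfl | rfl <;> simp)
  rcases ha₀ with rfl | rfl | rfl
  · rw [limitMeasure_zero, integral_nuZero φ.continuous]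
    -- The fibre averages at `0` and `π` may differ. Symmetrizing under `θ ↦ π - θ` gives a test
    -- function with a single value on `sin = 0`, even when the centres are not exactly `0`.
    have hsymm : ∀ n, ∫ θ, fiberAverage φ θ * circleDensity (b n) (a n) θ ∂haarCircle =
        ∫ θ, 2⁻¹ * (fiberAverage φ θ + fiberAverage φ ((Real.pi : ℝ) - θ)) *
          circleDensity (b n) (a n) θ ∂haarCircle := fun n => by
      have h := integral_reflect_mul_circleDensity (fiberAverage φ) (b n) (a n)
      simp_rw [mul_assoc, add_mul]
      rw [integral_const_mul, integral_add (integrable_haarCircle (by fun_prop))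
        (integrable_haarCircle (by fun_prop)), h]
      ring
    simp_rw [hsymm]
    refine tendsto_integral_mul_quadDensity continuous_circleSin hr hb hbt ha (by fun_prop)
      fun θ hθ => ?_
    rcases circleSin_eq_zero_iff.1 hθ with rfl | rfl
    · rw [sub_zero]
    · rw [sub_self, add_comm]
  · rw [limitMeasure_one, integral_nuPlus φ.continuous]
    exact tendsto_integral_mul_quadDensity continuous_circleSin hr hb hbt ha hF
      fun θ hθ => by rw [circleSin_eq_one hθ]
  · rw [limitMeasure_neg_one, integral_nuMinus φ.continuous]
    exact tendsto_integral_mul_quadDensity continuous_circleSin hr hb hbt ha hF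
      fun θ hθ => by rw [circleSin_eq_neg_one hθ]

theorem limitMeasure_mem_limitPoints {S : ℝ → (TwoRod → ℝ) → Prop} {b a : ℕ → ℝ} {a₀ : ℝ}
    (hb : ∀ n, 0 < b n) (hbt : Tendsto b atTop atTop) (ha : Tendsto a atTop (𝓝 a₀))
    (ha₀ : a₀ = 0 ∨ a₀ = 1 ∨ a₀ = -1)
    (hS : ∀ n, S (b n) (quadDensity twoRodMeasure sinDiff (b n) (a n))) :
    limitMeasure a₀ ∈ limitPoints twoRodMeasure S := by
  have hprob : ∀ n, IsProbabilityMeasure (twoRodMeasure.withDensity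
      fun p => ENNReal.ofReal (quadDensity twoRodMeasure sinDiff (b n) (a n) p)) := fun n => by
    have hq : IsDensity twoRodMeasure (quadDensity twoRodMeasure sinDiff (b n) (a n)) :=
      isDensity_quadDensity continuous_sinDiff.measurable (hb n).le (a n)
    refine ⟨?_⟩
    rw [withDensity_apply _ MeasurableSet.univ, Measure.restrict_univ,
      ← ofReal_integral_eq_lintegral_ofReal hq.integrable (ae_of_all _ hq.nonneg),
      hq.integral_eq_one, ENNReal.ofReal_one]
  exact ⟨b, _, fun n => ⟨_, hprob n⟩, hb, hbt, hS, fun n => rfl,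
    tendsto_limitMeasure hb hbt ha ha₀ fun n => rfl⟩

/-- Centres lie in `[-1, 1]`, so a subsequence converges; the measures keep their limit along it,
and uniqueness of weak limits identifies `ν`. `T` is the condition that members of `S` impose on
their centre. -/
theorem exists_of_mem_limitPoints {S : ℝ → (TwoRod → ℝ) → Prop} {T : ℝ → ℝ → Prop}
    (hST : ∀ b f, 0 < b → S b f → ∃ a, |a| ≤ 1 ∧ T b a ∧
      f =ᵐ[twoRodMeasure] quadDensity twoRodMeasure sinDiff b a)
    (hT : ∀ (b a : ℕ → ℝ) (a₀ : ℝ), (∀ n, 0 < b n) → Tendsto b atTop atTop →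
      Tendsto a atTop (𝓝 a₀) → (∀ n, |a n| ≤ 1) → (∀ n, T (b n) (a n)) →
      a₀ = 0 ∨ a₀ = 1 ∨ a₀ = -1) {ν : ProbabilityMeasure TwoRod}
    (hν : ν ∈ limitPoints twoRodMeasure S) :
    ∃ (b a : ℕ → ℝ) (a₀ : ℝ), (∀ n, 0 < b n) ∧ Tendsto b atTop atTop ∧
      Tendsto a atTop (𝓝 a₀) ∧ (∀ n, |a n| ≤ 1) ∧ (∀ n, T (b n) (a n)) ∧
      ν = limitMeasure a₀ := by
  obtain ⟨b, f, P, hb, hbt, hf, hP, hlim⟩ := hν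
  choose a ha1 hTa hae using fun n => hST (b n) (f n) (hb n) (hf n)
  obtain ⟨a₀, -, k, hk, hka⟩ := isCompact_Icc.tendsto_subseq fun n => abs_le.1 (ha1 n)
  have hkb := hbt.comp hk.tendsto_atTop
  refine ⟨b ∘ k, a ∘ k, a₀, fun n => hb _, hkb, hka, fun n => ha1 _, fun n => hTa _, ?_⟩
  have ha₀ := hT (b ∘ k) (a ∘ k) a₀ (fun n => hb _) hkb hka (fun n => ha1 _) fun n => hTa _
  refine tendsto_nhds_unique (hlim.comp hk.tendsto_atTop)
    (tendsto_limitMeasure (fun n => hb (k n)) hkb hka ha₀ fun n => ?_)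
  rw [Function.comp_apply, hP]
  refine withDensity_congr_ae ?_
  filter_upwards [hae (k n)] with p hp
  simp only [hp, Function.comp_apply]

theorem exists_maximizing_sequence : ∃ b a : ℕ → ℝ, (∀ n, 0 < b n) ∧ Tendsto b atTop atTop ∧
    (∀ n, ∀ a', |a'| ≤ 1 → quadPartition haarCircle circleSin (b n) a' ≤
      quadPartition haarCircle circleSin (b n) (a n)) ∧ Tendsto a atTop (𝓝 1) := by
  have h : ∀ n : ℕ, ∃ a, (0 ≤ a ∧ a ≤ 1) ∧ ∀ a', |a'| ≤ 1 →
      quadPartition haarCircle circleSin (n + 1) a' ≤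
        quadPartition haarCircle circleSin (n + 1) a := fun n => by
    obtain ⟨a, ha, hmax⟩ := exists_isMax_quadPartition (μ := haarCircle)
      continuous_circleSin.measurable (by positivity : (0 : ℝ) ≤ n + 1)
    -- `Z` is even in the centre, so a nonnegative maximizer exists; this excludes the limit `-1`.
    refine ⟨|a|, ⟨abs_nonneg a, ha⟩, fun a' ha' => (hmax a' ha').trans_eq ?_⟩
    rcases abs_choice a with h | h
    · rw [h]
    · rw [h, quadPartition_circle_neg]
  choose a ha hmax using h
  obtain ⟨a₀, ha₀, k, hk, hka⟩ := isCompact_Icc.tendsto_subseq fun n => ha n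
  have hbt : Tendsto (fun n => ((k n : ℕ) : ℝ) + 1) atTop atTop :=
    tendsto_atTop_add_const_right _ _ (tendsto_natCast_atTop_atTop.comp hk.tendsto_atTop)
  have hb : ∀ n, 0 < ((k n : ℕ) : ℝ) + 1 := fun n => by positivity
  have hlim := limit_of_isMax hb hbt hka
    (fun n => by rw [Function.comp_apply, abs_of_nonneg (ha _).1]; exact (ha _).2)
    fun n => hmax (k n)
  have h1 : a₀ = 1 := hlim.resolve_right fun h => by
    have := ha₀.1
    linarith
  rw [h1] at hka
  exact ⟨_, a ∘ k, hb, hbt, fun n => hmax (k n), hka⟩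

theorem isOnsagerSolution_twoRod_iff {b : ℝ} (hb : 0 ≤ b) {f : TwoRod → ℝ} :
    IsOnsagerSolution twoRodMeasure twoRodKernel b f ↔
      ∃ a, |a| ≤ 1 ∧ ∫ t, circleSin t * circleDensity b a t ∂haarCircle = a ∧
        f = quadDensity twoRodMeasure sinDiff b a := by
  simp_rw [← mean_twoRod]
  exact isOnsagerSolution_iff continuous_sinDiff.measurable abs_sinDiff_le hb

theorem isFreeEnergyMinimizer_twoRod_of_isMax {b a : ℝ} (hb : 0 < b)
    (hmax : ∀ a', |a'| ≤ 1 → quadPartition haarCircle circleSin b a' ≤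
      quadPartition haarCircle circleSin b a) :
    IsFreeEnergyMinimizer twoRodMeasure twoRodKernel b
      (quadDensity twoRodMeasure sinDiff b a) := by
  simp_rw [← quadPartition_twoRod] at hmax
  exact isFreeEnergyMinimizer_of_isMax continuous_sinDiff.measurable abs_sinDiff_le hb hmax

theorem isOnsagerSolution_twoRod_of_isMax {b a : ℝ} (hb : 0 < b)
    (hmax : ∀ a', |a'| ≤ 1 → quadPartition haarCircle circleSin b a' ≤
      quadPartition haarCircle circleSin b a) :
    IsOnsagerSolution twoRodMeasure twoRodKernel b (quadDensity twoRodMeasure sinDiff b a) := by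
  have hfix := mean_eq_of_isMax continuous_circleSin.measurable abs_circleSin_le hb hmax
  refine (isOnsagerSolution_twoRod_iff hb.le).2 ⟨a, ?_, hfix, rfl⟩
  have h := (isDensity_circleDensity hb.le a).abs_mean_le abs_circleSin_le
  rwa [hfix] at h

/-- Serves both theorems, since a maximizing centre gives a solution and a minimizer. Negating the
centres yields `nuMinus`. -/
theorem nuPlus_nuMinus_mem_limitPoints {S : ℝ → (TwoRod → ℝ) → Prop}
    (hS : ∀ b a, 0 < b → (∀ a', |a'| ≤ 1 → quadPartition haarCircle circleSin b a' ≤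
      quadPartition haarCircle circleSin b a) →
      S b (quadDensity twoRodMeasure sinDiff b a)) :
    nuPlus ∈ limitPoints twoRodMeasure S ∧ nuMinus ∈ limitPoints twoRodMeasure S := by
  obtain ⟨b, a, hb, hbt, hmax, ha⟩ := exists_maximizing_sequence
  rw [← limitMeasure_one, ← limitMeasure_neg_one]
  refine ⟨limitMeasure_mem_limitPoints hb hbt ha (by simp) fun n => hS _ _ (hb n) (hmax n),
    limitMeasure_mem_limitPoints hb hbt ha.neg (by simp) fun n => hS _ _ (hb n) fun a' ha' => ?_⟩
  rw [quadPartition_circle_neg]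
  exact hmax n a' ha'

theorem limitPoints_onsagerSolutions :
    limitPoints twoRodMeasure (IsOnsagerSolution twoRodMeasure twoRodKernel) =
      {nuZero, nuPlus, nuMinus} := by
  refine Set.Subset.antisymm (fun ν hν => ?_) ?_
  · obtain ⟨b, a, a₀, hb, hbt, ha, ha1, hT, rfl⟩ := exists_of_mem_limitPoints
      (T := fun b a => ∫ t, circleSin t * circleDensity b a t ∂haarCircle = a)
      (fun b f hb hf => by
        obtain ⟨a, h1, h2, h3⟩ := (isOnsagerSolution_twoRod_iff hb.le).1 hf
        exact ⟨a, h1, h2, h3 ▸ ae_eq_refl _⟩)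
      (fun b a a₀ hb hbt ha ha1 hT => limit_of_fixedPoints hb hbt ha ha1 hT) hν
    rcases limit_of_fixedPoints hb hbt ha ha1 hT with rfl | rfl | rfl
    · simp [limitMeasure_zero]
    · simp [limitMeasure_one]
    · simp [limitMeasure_neg_one]
  · have hpm := nuPlus_nuMinus_mem_limitPoints fun b a hb h =>
      isOnsagerSolution_twoRod_of_isMax hb h
    -- By oddness of the sine, the centre `0` is a fixed point for every `b`.
    have hzero : nuZero ∈ limitPoints twoRodMeasure
        (IsOnsagerSolution twoRodMeasure twoRodKernel) := by
      rw [← limitMeasure_zero]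
      refine limitMeasure_mem_limitPoints (b := fun n => (n : ℝ) + 1) (a := fun _ => 0)
        (fun n => by positivity)
        (tendsto_atTop_add_const_right _ _ tendsto_natCast_atTop_atTop)
        tendsto_const_nhds (by simp) fun n => ?_
      exact (isOnsagerSolution_twoRod_iff (by positivity)).2
        ⟨0, by simp, mean_circleDensity_zero _, rfl⟩
    rintro ν (rfl | rfl | rfl)
    exacts [hzero, hpm.1, hpm.2]

theorem limitPoints_freeEnergyMinimizers :
    limitPoints twoRodMeasure (IsFreeEnergyMinimizer twoRodMeasure twoRodKernel) =
      {nuPlus, nuMinus} := by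
  refine Set.Subset.antisymm (fun ν hν => ?_) ?_
  · obtain ⟨b, a, a₀, hb, hbt, ha, ha1, hT, rfl⟩ := exists_of_mem_limitPoints
      (T := fun b a => ∀ a', |a'| ≤ 1 → quadPartition haarCircle circleSin b a' ≤
        quadPartition haarCircle circleSin b a)
      (fun b f hb hf => by
        obtain ⟨a, h1, -, h2, h3⟩ := IsFreeEnergyMinimizer.exists_ae_eq
          continuous_sinDiff.measurable abs_sinDiff_le hb hf
        simp_rw [quadPartition_twoRod] at h2
        exact ⟨a, h1, h2, h3⟩)
      (fun b a a₀ hb hbt ha ha1 hT => Or.inr (limit_of_isMax hb hbt ha ha1 hT)) hν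
    rcases limit_of_isMax hb hbt ha ha1 hT with rfl | rfl
    · simp [limitMeasure_one]
    · simp [limitMeasure_neg_one]
  · have hpm := nuPlus_nuMinus_mem_limitPoints fun b a hb h =>
      isFreeEnergyMinimizer_twoRod_of_isMax hb h
    rintro ν (rfl | rfl)
    exacts [hpm.1, hpm.2]

/-! ### Supports of the three measures and their distinctness. -/

theorem ae_circleMeasure_sinDiff (θ : AddCircle (2 * Real.pi)) :
    ∀ᵐ p ∂circleMeasure θ, sinDiff p = circleSin θ := by
  unfold circleMeasure
  rw [ae_map_iff (Continuous.aemeasurable (by fun_prop))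
    (measurableSet_eq_fun continuous_sinDiff.measurable measurable_const)]
  exact ae_of_all _ fun t => by rw [sinDiff_eq]; simp

theorem ae_nuPlus_sinDiff : ∀ᵐ p ∂(nuPlus : Measure TwoRod), sinDiff p = 1 := by
  have h := ae_circleMeasure_sinDiff ((Real.pi / 2 : ℝ) : AddCircle (2 * Real.pi))
  rwa [circleSin_coe, Real.sin_pi_div_two] at h

theorem ae_nuMinus_sinDiff : ∀ᵐ p ∂(nuMinus : Measure TwoRod), sinDiff p = -1 := by
  have h := ae_circleMeasure_sinDiff ((-(Real.pi / 2) : ℝ) : AddCircle (2 * Real.pi))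
  rwa [circleSin_coe, Real.sin_neg, Real.sin_pi_div_two] at h

theorem ae_nuZero_sinDiff : ∀ᵐ p ∂(nuZero : Measure TwoRod), sinDiff p = 0 := by
  have h0 := ae_circleMeasure_sinDiff 0
  have h1 := ae_circleMeasure_sinDiff ((Real.pi : ℝ) : AddCircle (2 * Real.pi))
  rw [circleSin_zero] at h0
  rw [circleSin_coe, Real.sin_pi] at h1
  exact ae_add_measure_iff.2 ⟨Measure.ae_smul_measure h0 _, Measure.ae_smul_measure h1 _⟩

theorem ne_of_ae_sinDiff {ν ν' : ProbabilityMeasure TwoRod} {c c' : ℝ} (hc : c ≠ c')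
    (h : ∀ᵐ p ∂(ν : Measure TwoRod), sinDiff p = c)
    (h' : ∀ᵐ p ∂(ν' : Measure TwoRod), sinDiff p = c') : ν ≠ ν' := by
  rintro rfl
  obtain ⟨p, hp, hp'⟩ := (h.and h').exists
  exact hc (hp.symm.trans hp')

end TwoRod

end

end Corpora

theorem mainTheorem4 :
    Corpora.limitPoints Corpora.twoRodMeasure
        (Corpora.IsOnsagerSolution Corpora.twoRodMeasure Corpora.twoRodKernel) =
      {Corpora.nuZero, Corpora.nuPlus, Corpora.nuMinus} ∧
    Corpora.limitPoints Corpora.twoRodMeasure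
        (Corpora.IsFreeEnergyMinimizer Corpora.twoRodMeasure Corpora.twoRodKernel) =
      {Corpora.nuPlus, Corpora.nuMinus} ∧
    (Corpora.nuZero ≠ Corpora.nuPlus ∧ Corpora.nuZero ≠ Corpora.nuMinus ∧
      Corpora.nuPlus ≠ Corpora.nuMinus) ∧
    (∀ᵐ p ∂(Corpora.nuZero : MeasureTheory.Measure Corpora.TwoRod),
      Corpora.sinDiff p = 0 ∧ Corpora.orientedArea p = 0) ∧
    (∀ᵐ p ∂(Corpora.nuPlus : MeasureTheory.Measure Corpora.TwoRod),
      Corpora.sinDiff p = 1 ∧ Corpora.orientedArea p = -(1 / 2)) ∧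
    (∀ᵐ p ∂(Corpora.nuMinus : MeasureTheory.Measure Corpora.TwoRod),
      Corpora.sinDiff p = -1 ∧ Corpora.orientedArea p = 1 / 2) := by
  refine ⟨Corpora.limitPoints_onsagerSolutions, Corpora.limitPoints_freeEnergyMinimizers,
    ⟨Corpora.ne_of_ae_sinDiff (by norm_num) Corpora.ae_nuZero_sinDiff Corpora.ae_nuPlus_sinDiff,
      Corpora.ne_of_ae_sinDiff (by norm_num) Corpora.ae_nuZero_sinDiff Corpora.ae_nuMinus_sinDiff,
      Corpora.ne_of_ae_sinDiff (by norm_num) Corpora.ae_nuPlus_sinDiff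
        Corpora.ae_nuMinus_sinDiff⟩, ?_, ?_, ?_⟩
  · filter_upwards [Corpora.ae_nuZero_sinDiff] with p hp
    exact ⟨hp, by rw [Corpora.orientedArea_eq, hp]; norm_num⟩
  · filter_upwards [Corpora.ae_nuPlus_sinDiff] with p hp
    exact ⟨hp, by rw [Corpora.orientedArea_eq, hp]⟩
  · filter_upwards [Corpora.ae_nuMinus_sinDiff] with p hp
    exact ⟨hp, by rw [Corpora.orientedArea_eq, hp]; norm_num⟩
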